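/- Let $G$ be a discrete group and let $\rho$ be the left regular representation of $G$ on $\ell^2(G)$, $(\rho(g)x)(h)=x(g^{-1}h)$. Let $C^*_\rho(G)$ be the $C^*$-algebra of operators on $\ell^2(G)$ generated by $\{\rho(g):g\in G\}$, and let $VN(G)$ be the von Neumann algebra generated by it. Let $A(G)$ be the Fourier algebra of $G$: the Banach algebra, under pointwise multiplication, of the coefficient functions $g\mapsto\langle\rho(g)x,y\rangle$ ($x,y\in\ell^2(G)$) of $\rho$, with the norm of the dual space $C^*_\rho(G)'$ (a function $u\in A(G)$ being regarded as the functional on $C^*_\rho(G)$ with $\rho(g)\mapsto u(g)$; equivalently, $A(G)$ is the closed linear span of the coefficient functions of $\rho$ in $C^*_\rho(G)'$). The dual space $A(G)'$ is identified with $VN(G)$ by $\langle T,u\rangle=\langle Tx,y\rangle$ for $T\in VN(G)$ and $u=\langle\rho(\cdot)x,y\rangle$. Let $B_\rho(G)$ be the set of those functions on $G$ that are pointwise limits of nets in $A(G)$ which are bounded in the norm of $A(G)$; it is identified with $C^*_\rho(G)'$, a functional $\varphi$ corresponding to the function $g\mapsto\varphi(\rho(g))$. Let $p\colon A(G)''\to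 B_\rho(G)$ be the adjoint of the inclusion $C^*_\rho(G)\to VN(G)=A(G)'$. For a Banach algebra $A$, the first Arens product on $A''$ is defined by $\langle f\cdot a,b\rangle=\langle f,ab\rangle$, $\langle\Psi\cdot f,a\rangle=\langle\Psi,f\cdot a\rangle$, $\langle\Phi\,\square\,\Psi,f\rangle=\langle\Phi,\Psi\cdot f\rangle$ for $a,b\in A$, $f\in A'$, $\Phi,\Psi\in A''$, and the topological centre of $A''$ is $\mathfrak Z_t(A'')=\{\Phi\in A'':\ \Psi\mapsto\Phi\,\square\,\Psi\ \text{is weak*-continuous on } A''\}$. Assume that $A(G)$ has an approximate identity $(u_\alpha)$ which is bounded in the multiplier norm, i.e. $u_\alpha u\to u$ in $A(G)$ for every $u\in A(G)$, and the norms of the multiplication operators $u\mapsto u_\alpha u$ on $A(G)$ are bounded by a constant not depending on $\alpha$. Then $$p\big(\mathfrak Z_t(A(G)'')\big)=\{v\in B_\rho(G):\ L_v\colon A(G)\to A(G)\ \text{is weakly compact}\},$$ where $L_v(u)=v\,u$ (pointwise product). -/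

import Mathlib

open Filter Topology
open scoped ComplexConjugate InnerProductSpace ENNReal

noncomputable section

namespace FourierBidual

universe u

/-- The Hilbert space `ℓ²(G)`. -/
def ell2 (G : Type u) : Type u := lp (fun _ : G => ℂ) 2

instance (G : Type u) : NormedAddCommGroup (ell2 G) :=
  inferInstanceAs (NormedAddCommGroup (lp (fun _ : G => ℂ) 2))

instance (G : Type u) : InnerProductSpace ℂ (ell2 G) :=
  inferInstanceAs (InnerProductSpace ℂ (lp (fun _ : G => ℂ) 2))

instance (G : Type u) : CompleteSpace (ell2 G) :=
  inferInstanceAs (CompleteSpace (lp (fun _ : G => ℂ) 2))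

/-- The function on `G` underlying an element of `ℓ²(G)`. -/
def ell2.val {G : Type u} (x : ell2 G) (g : G) : ℂ := x.1 g

instance (G : Type u) : CoeFun (ell2 G) (fun _ => G → ℂ) := ⟨ell2.val⟩

theorem ell2_ext {G : Type u} {x y : ell2 G} (h : ∀ g, x g = y g) : x = y :=
  Subtype.ext (funext h)

/-- The element of `ℓ²(G)` given by a square summable function. -/
def ell2.mk {G : Type u} (f : G → ℂ) (hf : Summable fun h => ‖f h‖ ^ 2) : ell2 G :=
  ⟨f, memℓp_gen (by simpa using hf)⟩

@[simp] theorem ell2.mk_apply {G : Type u} (f : G → ℂ) (hf : Summable fun h => ‖f h‖ ^ 2) (g : G) :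
    ell2.mk f hf g = f g := rfl

section Regular
variable {G : Type u}

theorem ell2_summable_sq (x : ell2 G) : Summable fun h => ‖x h‖ ^ 2 := by
  have := (Subtype.property x : Memℓp (E := fun _ : G => ℂ) x.1 2).summable (by norm_num)
  simpa using! this

theorem ell2_hasSum_sq (x : ell2 G) : HasSum (fun h => ‖x h‖ ^ 2) (‖x‖ ^ 2) := by
  have := lp.hasSum_norm (E := fun _ : G => ℂ) (p := 2) (by norm_num) x
  simp only [ENNReal.toReal_ofNat, Real.rpow_ofNat] at this
  exact this

theorem ell2_hasSum_inner (x y : ell2 G) :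
    HasSum (fun h => y h * conj (x h)) ⟪x, y⟫_ℂ :=
  lp.hasSum_inner (𝕜 := ℂ) (G := fun _ : G => ℂ) x y

theorem opNorm_le_of_inner {T : ell2 G →L[ℂ] ell2 G} {C : ℝ} (hC : 0 ≤ C)
    (h : ∀ x y, ‖⟪y, T x⟫_ℂ‖ ≤ C * ‖x‖ * ‖y‖) : ‖T‖ ≤ C := by
  refine ContinuousLinearMap.opNorm_le_of_re_inner_le (𝕜 := ℂ) hC fun x y hx hy => ?_
  have h1 := h x y
  rw [hx, hy, mul_one, mul_one] at h1
  rw [inner_re_symm]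
  exact (Complex.re_le_norm _).trans h1

/-- The unit vector `δ_a`. -/
def delta (a : G) : ell2 G := by
  classical exact lp.single 2 a (1 : ℂ)

theorem ell2_mem_of_delta (S : Submodule ℂ (ell2 G)) (hS : IsClosed (S : Set (ell2 G)))
    (h : ∀ a, delta a ∈ S) (x : ell2 G) : x ∈ S := by
  classical
  have h1 := lp.hasSum_single (E := fun _ : G => ℂ) (p := 2) (by norm_num) x
  refine hS.mem_of_tendsto h1 (Eventually.of_forall fun s => sum_mem fun a _ => ?_)
  have h2 : lp.single (E := fun _ : G => ℂ) 2 a (x.1 a) = x.1 a • delta a := by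
    have := lp.single_smul (𝕜 := ℂ) (E := fun _ : G => ℂ) 2 a (x.1 a) 1
    simpa [delta] using! this
  rw [h2]
  exact S.smul_mem _ (h a)


variable [Group G]

/-- The translate `h ↦ x(g⁻¹ h)` of `x ∈ ℓ²(G)`. -/
def translate (g : G) (x : ell2 G) : ell2 G :=
  ell2.mk (fun h => x (g⁻¹ * h)) ((ell2_summable_sq x).comp_injective (mul_right_injective g⁻¹))

theorem norm_translate (g : G) (x : ell2 G) : ‖translate g x‖ = ‖x‖ := by
  have h1 := ell2_hasSum_sq (translate g x)
  have h2 := (Equiv.mulLeft g⁻¹).hasSum_iff (f := fun h => ‖x h‖ ^ 2) |>.mpr (ell2_hasSum_sq x)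
  exact (sq_eq_sq₀ (norm_nonneg _) (norm_nonneg _)).mp (h1.unique h2)

/-- The left regular representation: `(ρ(g) x)(h) = x (g⁻¹ h)`. -/
def leftReg (g : G) : ell2 G →L[ℂ] ell2 G :=
  LinearMap.mkContinuous
    { toFun := translate g
      map_add' := fun _ _ => ell2_ext fun _ => rfl
      map_smul' := fun _ _ => ell2_ext fun _ => rfl } 1
    (fun x => by simp [norm_translate])

@[simp] theorem leftReg_apply (g : G) (x : ell2 G) (h : G) : leftReg g x h = x (g⁻¹ * h) := rfl

theorem leftReg_mul (g h : G) : leftReg (g * h) = leftReg g * leftReg h := by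
  refine ContinuousLinearMap.ext fun x => ell2_ext fun k => ?_
  simp [mul_assoc]

theorem leftReg_one : leftReg (1 : G) = 1 := by
  refine ContinuousLinearMap.ext fun x => ell2_ext fun k => ?_
  simp

theorem leftReg_star (g : G) : star (leftReg g) = leftReg g⁻¹ := by
  symm
  rw [ContinuousLinearMap.star_eq_adjoint, ContinuousLinearMap.eq_adjoint_iff]
  intro x y
  have h1 := ((Equiv.mulLeft g).hasSum_iff (f := fun h => leftReg g y h * conj (x h))).mpr
    (ell2_hasSum_inner x (leftReg g y))
  have h2 : (fun h => leftReg g y h * conj (x h)) ∘ Equiv.mulLeft g =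
      fun h => y h * conj (leftReg g⁻¹ x h) := by
    funext h
    simp
  rw [h2] at h1
  exact (ell2_hasSum_inner (leftReg g⁻¹ x) y).unique h1

end Regular

/-- `C*_ρ(G)`, the C*-algebra of operators on `ℓ²(G)` generated by the `ρ(g)`, `g ∈ G`. -/
def reducedCstarSubalgebra (G : Type u) [Group G] : StarSubalgebra ℂ (ell2 G →L[ℂ] ell2 G) :=
  (StarAlgebra.adjoin ℂ (Set.range (leftReg (G := G)))).topologicalClosure

/-- `C*_ρ(G)` as a Banach space with the operator norm. -/
def ReducedCstar (G : Type u) [Group G] : Type u := reducedCstarSubalgebra G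

instance (G : Type u) [Group G] : NormedAddCommGroup (ReducedCstar G) :=
  inferInstanceAs (NormedAddCommGroup (reducedCstarSubalgebra G))

instance (G : Type u) [Group G] : NormedSpace ℂ (ReducedCstar G) :=
  inferInstanceAs (NormedSpace ℂ (reducedCstarSubalgebra G))

instance (G : Type u) [Group G] : CompleteSpace (ReducedCstar G) :=
  (StarSubalgebra.isClosed_topologicalClosure
    (StarAlgebra.adjoin ℂ (Set.range (leftReg (G := G))))).completeSpace_coe

section Coefficients
variable {G : Type u} [Group G]

/-- An element of `C*_ρ(G)` as an operator on `ℓ²(G)`. -/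
def toOperator : ReducedCstar G →L[ℂ] ell2 G →L[ℂ] ell2 G :=
  (reducedCstarSubalgebra G).toSubalgebra.toSubmodule.subtypeL

theorem norm_toOperator (T : ReducedCstar G) : ‖toOperator T‖ = ‖T‖ := rfl

/-- `ρ(g)` as an element of `C*_ρ(G)`. -/
def rho (g : G) : ReducedCstar G :=
  ⟨leftReg g, StarSubalgebra.le_topologicalClosure _
    (StarAlgebra.subset_adjoin ℂ _ (Set.mem_range_self g))⟩

@[simp] theorem toOperator_rho (g : G) : toOperator (rho g) = leftReg g := rfl

/-- `f ↦ ∑ f(g) ρ(g)` for finitely supported functions `f`. -/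
def rhoSum : (G →₀ ℂ) →ₗ[ℂ] ReducedCstar G := Finsupp.linearCombination ℂ rho

theorem rhoSum_single (g : G) (c : ℂ) : rhoSum (Finsupp.single g c) = c • rho g := by
  simp [rhoSum]

theorem rhoSum_coe (f : G →₀ ℂ) :
    toOperator (rhoSum f) = f.sum fun g c => c • leftReg g := by
  simp [rhoSum, Finsupp.linearCombination_apply, Finsupp.sum]

theorem rhoSum_denseRange : DenseRange (rhoSum (G := G)) := by
  have key : ∀ T ∈ StarAlgebra.adjoin ℂ (Set.range (leftReg (G := G))),
      T ∈ Submodule.span ℂ (Set.range (leftReg (G := G))) := by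
    intro T hT
    induction hT using StarAlgebra.adjoin_induction with
    | mem x hx => exact Submodule.subset_span hx
    | algebraMap r =>
      rw [Algebra.algebraMap_eq_smul_one, ← leftReg_one (G := G)]
      exact Submodule.smul_mem _ _ (Submodule.subset_span ⟨1, rfl⟩)
    | add x y _ _ hx hy => exact add_mem hx hy
    | mul x y _ _ hx hy =>
      have := Submodule.mul_mem_mul hx hy
      rw [Submodule.span_mul_span] at this
      refine Submodule.span_mono ?_ this
      rintro _ ⟨_, ⟨g, rfl⟩, _, ⟨h, rfl⟩, rfl⟩
      exact ⟨g * h, leftReg_mul g h⟩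
    | star x hx' hx =>
      clear hx'
      induction hx using Submodule.span_induction with
      | mem x hx =>
        obtain ⟨g, rfl⟩ := hx
        exact Submodule.subset_span ⟨g⁻¹, (leftReg_star g).symm⟩
      | zero => simp
      | add x y _ _ hx hy => rw [star_add]; exact add_mem hx hy
      | smul a x _ hx => rw [star_smul]; exact Submodule.smul_mem _ _ hx
  intro T
  have hi : Topology.IsInducing (toOperator : ReducedCstar G → ell2 G →L[ℂ] ell2 G) :=
    Topology.IsInducing.subtypeVal
  rw [hi.closure_eq_preimage_closure_image]
  refine closure_mono ?_ T.2
  intro S hS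
  have := key S hS
  rw [← Set.range_comp]
  rw [Finsupp.mem_span_range_iff_exists_finsupp] at this
  obtain ⟨c, rfl⟩ := this
  exact ⟨c, rhoSum_coe c⟩

theorem hasSum_prodVec_aux (x x' : ell2 G) :
    HasSum (fun q : G × G => ‖x q.2 * x' (q.2 * q.1)‖ ^ 2) (‖x‖ ^ 2 * ‖x'‖ ^ 2) := by
  let e : G × G ≃ G × G :=
    { toFun := fun q => (q.2, q.2 * q.1)
      invFun := fun q => (q.1⁻¹ * q.2, q.1)
      left_inv := fun q => by simp
      right_inv := fun q => by simp }
  have h := (ell2_hasSum_sq x).mul (ell2_hasSum_sq x')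
    (Summable.mul_of_nonneg (f := fun h => ‖x h‖ ^ 2) (g := fun h => ‖x' h‖ ^ 2)
      (ell2_summable_sq x) (ell2_summable_sq x') (fun _ => sq_nonneg _) (fun _ => sq_nonneg _))
  have h1 := (e.hasSum_iff (f := fun q : G × G => ‖x q.1‖ ^ 2 * ‖x' q.2‖ ^ 2)).mpr h
  simpa [Function.comp_def, e, mul_pow] using h1

theorem summable_prodVec_row (x x' : ell2 G) (s : G) :
    Summable fun h => ‖x h * x' (h * s)‖ ^ 2 := by
  have h := (hasSum_prodVec_aux x x').summable
  exact h.comp_injective (i := fun k : G => (s, k)) (fun a b hab => by simpa using hab)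

/-- The vector `h ↦ x(h) x'(h s)`. -/
def prodVec (x x' : ell2 G) (s : G) : ell2 G :=
  ell2.mk (fun h => x h * x' (h * s)) (summable_prodVec_row x x' s)

theorem hasSum_prodVec (x x' : ell2 G) :
    HasSum (fun s => ‖prodVec x x' s‖ ^ 2) (‖x‖ ^ 2 * ‖x'‖ ^ 2) :=
  HasSum.prod_fiberwise (f := fun q : G × G => ‖x q.2 * x' (q.2 * q.1)‖ ^ 2)
    (g := fun s => ‖prodVec x x' s‖ ^ 2) (hasSum_prodVec_aux x x')
    fun s => ell2_hasSum_sq (prodVec x x' s)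

theorem hasSum_inner_prodVec (x y x' y' : ell2 G) (g : G) :
    HasSum (fun s => ⟪prodVec y y' s, leftReg g (prodVec x x' s)⟫_ℂ)
      (⟪y, leftReg g x⟫_ℂ * ⟪y', leftReg g x'⟫_ℂ) := by
  let e : G × G ≃ G × G :=
    { toFun := fun q => (q.2, q.2 * q.1)
      invFun := fun q => (q.1⁻¹ * q.2, q.1)
      left_inv := fun q => by simp
      right_inv := fun q => by simp }
  have h1 := ell2_hasSum_inner y (leftReg g x)
  have h2 := ell2_hasSum_inner y' (leftReg g x')
  have h := h1.mul h2 (summable_mul_of_summable_norm (f := fun h => leftReg g x h * conj (y h))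
    (g := fun h => leftReg g x' h * conj (y' h)) h1.summable.norm h2.summable.norm)
  have h3 := (e.hasSum_iff (f := fun q : G × G => leftReg g x q.1 * conj (y q.1) *
      (leftReg g x' q.2 * conj (y' q.2)))).mpr h
  have h4 : ∀ s, HasSum (fun k => ((fun q : G × G => leftReg g x q.1 * conj (y q.1) *
      (leftReg g x' q.2 * conj (y' q.2))) ∘ e) (s, k))
      ⟪prodVec y y' s, leftReg g (prodVec x x' s)⟫_ℂ := by
    intro s
    have h5 := ell2_hasSum_inner (prodVec y y' s) (leftReg g (prodVec x x' s))
    have h6 : (fun k => ((fun q : G × G => leftReg g x q.1 * conj (y q.1) *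
      (leftReg g x' q.2 * conj (y' q.2))) ∘ e) (s, k)) = fun h =>
        leftReg g (prodVec x x' s) h * conj (prodVec y y' s h) := by
      funext h
      simp only [e, prodVec, Function.comp_apply, Equiv.coe_fn_mk, leftReg_apply, ell2.mk_apply,
        map_mul, mul_assoc]
      ring
    rw [h6]
    exact h5
  exact HasSum.prod_fiberwise h3 h4

theorem inner_rhoSum (f : G →₀ ℂ) (x y : ell2 G) :
    ⟪y, toOperator (rhoSum f) x⟫_ℂ = f.sum fun g c => c * ⟪y, leftReg g x⟫_ℂ := by
  rw [rhoSum_coe, Finsupp.sum, Finsupp.sum, sum_apply, inner_sum]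
  simp [inner_smul_right]

theorem norm_mulCoeff_le (f : G →₀ ℂ) (x y x' y' : ell2 G) :
    ‖f.sum fun g c => c * (⟪y, leftReg g x⟫_ℂ * ⟪y', leftReg g x'⟫_ℂ)‖ ≤
      ‖rhoSum f‖ * ‖x‖ * ‖y‖ * ‖x'‖ * ‖y'‖ := by
  have hs : HasSum (fun s => ⟪prodVec y y' s, toOperator (rhoSum f) (prodVec x x' s)⟫_ℂ)
      (f.sum fun g c => c * (⟪y, leftReg g x⟫_ℂ * ⟪y', leftReg g x'⟫_ℂ)) := by
    simp only [inner_rhoSum, Finsupp.sum]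
    exact hasSum_sum fun g _ => (hasSum_inner_prodVec x y x' y' g).mul_left _
  have hX := hasSum_prodVec x x'
  have hY := hasSum_prodVec y y'
  have hc := Real.summable_and_inner_le_Lp_mul_Lq_tsum_of_nonneg
    (f := fun s => ‖prodVec x x' s‖) (g := fun s => ‖prodVec y y' s‖) (p := 2) (q := 2)
    (by constructor <;> norm_num) (fun _ => norm_nonneg _) (fun _ => norm_nonneg _)
    (by simpa using hX.summable) (by simpa using hY.summable)
  obtain ⟨hc1, hc2⟩ := hc
  have hle : ∀ s, ‖⟪prodVec y y' s, toOperator (rhoSum f) (prodVec x x' s)⟫_ℂ‖ ≤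
      ‖rhoSum f‖ * (‖prodVec x x' s‖ * ‖prodVec y y' s‖) := by
    intro s
    refine (norm_inner_le_norm _ _).trans ?_
    have := (toOperator (rhoSum f)).le_opNorm (prodVec x x' s)
    calc _ ≤ ‖prodVec y y' s‖ * (‖toOperator (rhoSum f)‖ * ‖prodVec x x' s‖) := by gcongr
      _ = _ := by rw [norm_toOperator]; ring
  rw [← hs.tsum_eq]
  refine (tsum_of_norm_bounded ((hc1.hasSum).mul_left _) hle).trans ?_
  have e1 : (∑' i, ‖prodVec x x' i‖ ^ (2:ℝ)) ^ (1 / 2 : ℝ) = ‖x‖ * ‖x'‖ := by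
    simp only [Real.rpow_two, hX.tsum_eq, ← mul_pow, ← Real.sqrt_eq_rpow]
    exact Real.sqrt_sq (by positivity)
  have e2 : (∑' i, ‖prodVec y y' i‖ ^ (2:ℝ)) ^ (1 / 2 : ℝ) = ‖y‖ * ‖y'‖ := by
    simp only [Real.rpow_two, hY.tsum_eq, ← mul_pow, ← Real.sqrt_eq_rpow]
    exact Real.sqrt_sq (by positivity)
  rw [e1, e2] at hc2
  calc _ ≤ ‖rhoSum f‖ * (‖x‖ * ‖x'‖ * (‖y‖ * ‖y'‖)) := by gcongr
    _ = _ := by ring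


/-- The coefficient functional `T ↦ ⟨T x, y⟩` on `C*_ρ(G)`. -/
def coeffFunctional (x y : ell2 G) : StrongDual ℂ (ReducedCstar G) :=
  (innerSL ℂ y).comp ((ContinuousLinearMap.apply ℂ (ell2 G) x).comp
    toOperator)

@[simp] theorem coeffFunctional_apply (x y : ell2 G) (T : ReducedCstar G) :
    coeffFunctional x y T = ⟪y, toOperator T x⟫_ℂ := rfl

/-- The function `g ↦ φ(ρ(g))` on `G` which represents a functional `φ` on `C*_ρ(G)`. -/
def toFunction (φ : StrongDual ℂ (ReducedCstar G)) (g : G) : ℂ := φ (rho g)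

theorem apply_rhoSum (φ : StrongDual ℂ (ReducedCstar G)) (f : G →₀ ℂ) :
    φ (rhoSum f) = f.sum fun g c => c * toFunction φ g := by
  simp [rhoSum, Finsupp.linearCombination_apply, Finsupp.sum, toFunction]

theorem toFunction_injective : Function.Injective (toFunction (G := G)) := by
  intro φ ψ h
  have : (φ : ReducedCstar G → ℂ) = ψ := by
    refine rhoSum_denseRange.equalizer φ.continuous ψ.continuous (funext fun f => ?_)
    simp [apply_rhoSum, h]
  exact DFunLike.coe_injective this

/-- `f ↦ v f` on finitely supported functions, with values in `C*_ρ(G)`. -/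
def mulRhoSum (v : G → ℂ) : (G →₀ ℂ) →ₗ[ℂ] ReducedCstar G :=
  Finsupp.linearCombination ℂ fun g => v g • rho g

theorem inner_mulRhoSum (v : G → ℂ) (f : G →₀ ℂ) (x y : ell2 G) :
    ⟪y, toOperator (mulRhoSum v f) x⟫_ℂ = f.sum fun g c => c * (v g * ⟪y, leftReg g x⟫_ℂ) := by
  have h : toOperator (mulRhoSum v f) = f.sum fun g c => c • v g • leftReg g := by
    simp [mulRhoSum, Finsupp.linearCombination_apply, Finsupp.sum]
  rw [h, Finsupp.sum, Finsupp.sum, sum_apply, inner_sum]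
  simp [inner_smul_right]

theorem norm_mulRhoSum_coeff_le (f : G →₀ ℂ) (x y : ell2 G) :
    ‖mulRhoSum (fun g => ⟪y, leftReg g x⟫_ℂ) f‖ ≤ ‖rhoSum f‖ * ‖x‖ * ‖y‖ := by
  rw [← norm_toOperator]
  refine opNorm_le_of_inner (by positivity) fun x' y' => ?_
  rw [inner_mulRhoSum]
  exact norm_mulCoeff_le f x y x' y'

theorem norm_mulRhoSum_le (φ : StrongDual ℂ (ReducedCstar G)) (f : G →₀ ℂ) :
    ‖mulRhoSum (toFunction φ) f‖ ≤ ‖φ‖ * ‖rhoSum f‖ := by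
  rw [← norm_toOperator]
  refine opNorm_le_of_inner (by positivity) fun x y => ?_
  have h : ⟪y, toOperator (mulRhoSum (toFunction φ) f) x⟫_ℂ =
      φ (mulRhoSum (fun g => ⟪y, leftReg g x⟫_ℂ) f) := by
    rw [inner_mulRhoSum]
    simp [mulRhoSum, Finsupp.linearCombination_apply, Finsupp.sum, toFunction, mul_comm]
  rw [h]
  calc _ ≤ ‖φ‖ * (‖rhoSum f‖ * ‖x‖ * ‖y‖) :=
        φ.le_opNorm_of_le (norm_mulRhoSum_coeff_le f x y)
    _ = _ := by ring

/-- The operator on `C*_ρ(G)` with `ρ(g) ↦ φ(ρ(g)) ρ(g)`. -/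
def multiplier (φ : StrongDual ℂ (ReducedCstar G)) : ReducedCstar G →L[ℂ] ReducedCstar G :=
  (mulRhoSum (toFunction φ)).extendOfNorm rhoSum

theorem multiplier_rho (φ : StrongDual ℂ (ReducedCstar G)) (g : G) :
    multiplier φ (rho g) = toFunction φ g • rho g := by
  have h := LinearMap.extendOfNorm_eq rhoSum_denseRange ⟨‖φ‖, norm_mulRhoSum_le φ⟩
    (Finsupp.single g 1)
  simpa [multiplier, rhoSum_single, mulRhoSum] using h

theorem norm_multiplier_le (φ : StrongDual ℂ (ReducedCstar G)) : ‖multiplier φ‖ ≤ ‖φ‖ :=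
  ContinuousLinearMap.opNorm_le_bound (multiplier φ) (norm_nonneg φ) fun T =>
    LinearMap.norm_extendOfNorm_apply_le (f := mulRhoSum (toFunction φ)) (e := rhoSum)
      rhoSum_denseRange ‖φ‖ (norm_mulRhoSum_le φ) T

/-- The pointwise product of two elements of `C*_ρ(G)'`, regarded as functions on `G`. -/
def mulDual (φ ψ : StrongDual ℂ (ReducedCstar G)) : StrongDual ℂ (ReducedCstar G) :=
  ψ.comp (multiplier φ)

theorem toFunction_mulDual (φ ψ : StrongDual ℂ (ReducedCstar G)) (g : G) :
    toFunction (mulDual φ ψ) g = toFunction φ g * toFunction ψ g := by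
  simp [toFunction, mulDual, multiplier_rho]

theorem norm_mulDual_le (φ ψ : StrongDual ℂ (ReducedCstar G)) :
    ‖mulDual φ ψ‖ ≤ ‖φ‖ * ‖ψ‖ := by
  refine (ContinuousLinearMap.opNorm_comp_le _ _).trans ?_
  rw [mul_comm]
  gcongr
  exact norm_multiplier_le φ

/-- The closed linear span in the Banach space `C*_ρ(G)'` of the coefficients of `ρ`. -/
def fourierSubmodule (G : Type u) [Group G] :
    Submodule ℂ (StrongDual ℂ (ReducedCstar G)) :=
  (Submodule.span ℂ {φ | ∃ x y : ell2 G, φ = coeffFunctional x y}).topologicalClosure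

theorem coeffFunctional_mem (x y : ell2 G) : coeffFunctional x y ∈ fourierSubmodule G :=
  Submodule.le_topologicalClosure _ (Submodule.subset_span ⟨x, y, rfl⟩)

theorem mulDual_delta_mem (φ : StrongDual ℂ (ReducedCstar G)) (a b : G) :
    mulDual φ (coeffFunctional (delta a) (delta b)) ∈ fourierSubmodule G := by
  classical
  have h : mulDual φ (coeffFunctional (delta a) (delta b)) =
      toFunction φ (b * a⁻¹) • coeffFunctional (delta a) (delta b) := by
    refine toFunction_injective (funext fun g => ?_)
    rw [toFunction_mulDual]
    have h1 : toFunction (coeffFunctional (delta a) (delta b)) g = delta a (g⁻¹ * b) := by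
      have := lp.inner_single_left (𝕜 := ℂ) (G := fun _ : G => ℂ) b (1 : ℂ)
        (leftReg g (delta a))
      refine Eq.trans ?_ (this.trans ?_)
      · simp only [toFunction, rho, delta]; rfl
      · rw [RCLike.inner_apply, map_one, mul_one]
        rfl
    change _ = toFunction φ (b * a⁻¹) * toFunction (coeffFunctional (delta a) (delta b)) g
    rw [h1]
    by_cases hg : g = b * a⁻¹
    · rw [hg]
    · have h2 : delta a (g⁻¹ * b) = 0 := by
        have hne : g⁻¹ * b ≠ a := fun h => hg (by rw [← h]; simp)
        exact lp.single_apply_ne (E := fun _ : G => ℂ) 2 a (1 : ℂ) hne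
      rw [h2, mul_zero, mul_zero]
  rw [h]
  exact Submodule.smul_mem _ _ (coeffFunctional_mem _ _)

theorem continuous_coeffFunctional :
    Continuous fun q : ell2 G × ell2 G => coeffFunctional q.1 q.2 := by
  unfold coeffFunctional
  fun_prop

theorem mulDual_coeff_mem (φ : StrongDual ℂ (ReducedCstar G)) (x y : ell2 G) :
    mulDual φ (coeffFunctional x y) ∈ fourierSubmodule G := by
  have hcl : IsClosed (fourierSubmodule G : Set (StrongDual ℂ (ReducedCstar G))) :=
    Submodule.isClosed_topologicalClosure _
  have hc : Continuous fun q : ell2 G × ell2 G => mulDual φ (coeffFunctional q.1 q.2) :=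
    continuous_coeffFunctional.clm_comp continuous_const
  let S (y : ell2 G) : Submodule ℂ (ell2 G) :=
    { carrier := {x | mulDual φ (coeffFunctional x y) ∈ fourierSubmodule G}
      zero_mem' := by
        have : mulDual φ (coeffFunctional 0 y) = 0 := by ext T; simp [mulDual]
        simp [this]
      add_mem' := fun {x x'} hx hx' => by
        have : mulDual φ (coeffFunctional (x + x') y) =
            mulDual φ (coeffFunctional x y) + mulDual φ (coeffFunctional x' y) := by
          ext T; simp [mulDual]
        simpa [this] using add_mem hx hx'
      smul_mem' := fun c x hx => by
        have : mulDual φ (coeffFunctional (c • x) y) = c • mulDual φ (coeffFunctional x y) := by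
          ext T; simp [mulDual]
        simpa [this] using Submodule.smul_mem _ c hx }
  let R (x : ell2 G) : Submodule ℂ (ell2 G) :=
    { carrier := {y | mulDual φ (coeffFunctional x y) ∈ fourierSubmodule G}
      zero_mem' := by
        have : mulDual φ (coeffFunctional x 0) = 0 := by ext T; simp [mulDual]
        simp [this]
      add_mem' := fun {y y'} hy hy' => by
        have : mulDual φ (coeffFunctional x (y + y')) =
            mulDual φ (coeffFunctional x y) + mulDual φ (coeffFunctional x y') := by
          ext T; simp [mulDual]
        simpa [this] using add_mem hy hy'
      smul_mem' := fun c y hy => by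
        have : mulDual φ (coeffFunctional x (c • y)) =
            conj c • mulDual φ (coeffFunctional x y) := by
          ext T; simp [mulDual, mul_comm]
        simpa [this] using Submodule.smul_mem _ (conj c) hy }
  have hS : ∀ y, IsClosed (S y : Set (ell2 G)) := fun y =>
    hcl.preimage (hc.comp (continuous_id.prodMk continuous_const))
  have hR : ∀ x, IsClosed (R x : Set (ell2 G)) := fun x =>
    hcl.preimage (hc.comp (continuous_const.prodMk continuous_id))
  refine ell2_mem_of_delta (R x) (hR x) (fun b => ?_) y
  exact ell2_mem_of_delta (S (delta b)) (hS _) (fun a => mulDual_delta_mem φ a b) x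

theorem mulDual_mem (φ : StrongDual ℂ (ReducedCstar G)) {ψ : StrongDual ℂ (ReducedCstar G)}
    (hψ : ψ ∈ fourierSubmodule G) : mulDual φ ψ ∈ fourierSubmodule G := by
  let L : StrongDual ℂ (ReducedCstar G) →L[ℂ] StrongDual ℂ (ReducedCstar G) :=
    (ContinuousLinearMap.compL ℂ (ReducedCstar G) (ReducedCstar G) ℂ).flip (multiplier φ)
  have h1 : fourierSubmodule G ≤ (fourierSubmodule G).comap L.toLinearMap := by
    refine Submodule.topologicalClosure_minimal _ (Submodule.span_le.mpr ?_)
      ((Submodule.isClosed_topologicalClosure _).preimage L.continuous)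
    rintro _ ⟨x, y, rfl⟩
    exact mulDual_coeff_mem φ x y
  exact h1 hψ

end Coefficients

/-- The Fourier algebra `A(G)` of the discrete group `G`: the closed linear span of the coefficient
functions `g ↦ ⟨ρ(g) x, y⟩` of the regular representation, in the norm of `C*_ρ(G)'`. (By a theorem
of Eymard each element of this closed linear span is itself a single coefficient function.) -/
def FourierAlgebra (G : Type u) [Group G] : Type u := fourierSubmodule G

section Fourier
variable {G : Type u} [Group G]

instance : NormedAddCommGroup (FourierAlgebra G) :=
  inferInstanceAs (NormedAddCommGroup (fourierSubmodule G))

instance : NormedSpace ℂ (FourierAlgebra G) :=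
  inferInstanceAs (NormedSpace ℂ (fourierSubmodule G))

instance : CompleteSpace (FourierAlgebra G) :=
  (Submodule.isClosed_topologicalClosure
    (Submodule.span ℂ {φ : StrongDual ℂ (ReducedCstar G) |
      ∃ x y : ell2 G, φ = coeffFunctional x y})).completeSpace_coe

/-- `A(G)` as a closed subspace of `C*_ρ(G)'`. -/
def toDual : FourierAlgebra G →L[ℂ] StrongDual ℂ (ReducedCstar G) :=
  (fourierSubmodule G).subtypeL

theorem norm_toDual (u : FourierAlgebra G) : ‖toDual u‖ = ‖u‖ := rfl

theorem toDual_injective : Function.Injective (toDual (G := G)) := Subtype.val_injective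

/-- Elements of `A(G)` are functions on `G`: `u(g)` is the value of `u` at `ρ(g)`. -/
instance : CoeFun (FourierAlgebra G) fun _ => G → ℂ := ⟨fun u => toFunction (toDual u)⟩

theorem fourier_ext {u v : FourierAlgebra G} (h : ∀ g, u g = v g) : u = v :=
  toDual_injective (toFunction_injective (funext h))

theorem add_apply (u v : FourierAlgebra G) (g : G) : (u + v) g = u g + v g := by
  simp [toFunction]

theorem smul_apply (c : ℂ) (u : FourierAlgebra G) (g : G) : (c • u) g = c * u g := by
  simp [toFunction]

theorem zero_apply (g : G) : (0 : FourierAlgebra G) g = 0 := by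
  simp [toFunction]

/-- Pointwise multiplication on `A(G)`. -/
instance : Mul (FourierAlgebra G) :=
  ⟨fun u v => ⟨mulDual (toDual u) (toDual v), mulDual_mem _ v.2⟩⟩

theorem mul_apply (u v : FourierAlgebra G) (g : G) : (u * v) g = u g * v g :=
  toFunction_mulDual (toDual u) (toDual v) g

instance : NonUnitalNormedCommRing (FourierAlgebra G) :=
  { (inferInstance : NormedAddCommGroup (FourierAlgebra G)),
    (inferInstance : Mul (FourierAlgebra G)) with
    left_distrib := fun u v w => fourier_ext fun g => by simp only [mul_apply, add_apply]; ring
    right_distrib := fun u v w => fourier_ext fun g => by simp only [mul_apply, add_apply]; ring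
    zero_mul := fun u => fourier_ext fun g => by simp only [mul_apply, zero_apply]; ring
    mul_zero := fun u => fourier_ext fun g => by simp only [mul_apply, zero_apply]; ring
    mul_assoc := fun u v w => fourier_ext fun g => by simp only [mul_apply]; ring
    mul_comm := fun u v => fourier_ext fun g => by simp only [mul_apply]; ring
    norm_mul_le := fun u v => norm_mulDual_le (toDual u) (toDual v) }

instance : IsScalarTower ℂ (FourierAlgebra G) (FourierAlgebra G) :=
  ⟨fun c u v => fourier_ext fun g => by
    simp only [smul_eq_mul, mul_apply, smul_apply]; ring⟩

instance : SMulCommClass ℂ (FourierAlgebra G) (FourierAlgebra G) :=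
  ⟨fun c u v => fourier_ext fun g => by
    simp only [smul_eq_mul, mul_apply, smul_apply]; ring⟩


/-- `B_ρ(G)`: the functions on `G` that are pointwise limits of nets in `A(G)` which are bounded
in the norm of `A(G)`. -/
def reducedFourierStieltjes (G : Type u) [Group G] : Set (G → ℂ) :=
  {v | ∃ C : ℝ, v ∈ closure {w : G → ℂ | ∃ u : FourierAlgebra G, ‖u‖ ≤ C ∧ w = u}}

/-- Each element of `B_ρ(G)` is given by a functional on `C*_ρ(G)`. -/
theorem exists_dual_of_mem {v : G → ℂ} (hv : v ∈ reducedFourierStieltjes G) :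
    ∃ φ : StrongDual ℂ (ReducedCstar G), toFunction φ = v := by
  obtain ⟨C, hC⟩ := hv
  have hK := WeakDual.isCompact_closedBall (𝕜 := ℂ) (E := ReducedCstar G) 0 C
  have hF : Continuous fun (ψ : WeakDual ℂ (ReducedCstar G)) (g : G) => ψ (rho g) :=
    continuous_pi fun g => WeakDual.eval_continuous (rho g)
  have hcl := (hK.image hF).isClosed
  have hsub : {w : G → ℂ | ∃ u : FourierAlgebra G, ‖u‖ ≤ C ∧ w = u} ⊆
      (fun (ψ : WeakDual ℂ (ReducedCstar G)) (g : G) => ψ (rho g)) ''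
        (WeakDual.toStrongDual ⁻¹' Metric.closedBall 0 C) := by
    rintro _ ⟨u, hu, rfl⟩
    refine ⟨StrongDual.toWeakDual (toDual u), ?_, rfl⟩
    change toDual u ∈ Metric.closedBall 0 C
    rw [mem_closedBall_zero_iff]
    exact hu
  obtain ⟨ψ, -, hψ⟩ := closure_minimal hsub hcl hC
  exact ⟨WeakDual.toStrongDual ψ, hψ⟩

/-- The multiplication operator `L_v : A(G) → A(G)`, `u ↦ v u`, for `v ∈ B_ρ(G)`. -/
def mulOperator (v : reducedFourierStieltjes G) : FourierAlgebra G →L[ℂ] FourierAlgebra G :=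
  ContinuousLinearMap.codRestrict
    (((ContinuousLinearMap.compL ℂ (ReducedCstar G) (ReducedCstar G) ℂ).flip
      (multiplier (exists_dual_of_mem v.2).choose)).comp toDual)
    (fourierSubmodule G) fun u => mulDual_mem _ u.2

theorem mulOperator_apply (v : reducedFourierStieltjes G) (u : FourierAlgebra G) (g : G) :
    mulOperator v u g = v.1 g * u g := by
  have h := toFunction_mulDual (exists_dual_of_mem v.2).choose (toDual u) g
  rw [(exists_dual_of_mem v.2).choose_spec] at h
  exact h

/-- The inclusion of `C*_ρ(G)` in `VN(G)`, where `VN(G)` is identified with `A(G)'` in the usual way: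
an operator `T` acts on the coefficient function `u(g) = ⟨ρ(g) x, y⟩` by `⟨T, u⟩ = ⟨T x, y⟩`. -/
def inclusionVN (G : Type u) [Group G] :
    ReducedCstar G →L[ℂ] StrongDual ℂ (FourierAlgebra G) :=
  ContinuousLinearMap.flip toDual

theorem inclusionVN_coeff (T : ReducedCstar G) (x y : ell2 G) :
    inclusionVN G T ⟨coeffFunctional x y, coeffFunctional_mem x y⟩ = ⟪y, toOperator T x⟫_ℂ := rfl

/-- The map `p : A(G)'' → B_ρ(G) ≅ C*_ρ(G)'`, the adjoint of the inclusion of `C*_ρ(G)` in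
`VN(G) = A(G)'`; the values are regarded as functions on `G`. -/
def restrictionMap (Φ : StrongDual ℂ (StrongDual ℂ (FourierAlgebra G))) : G → ℂ :=
  toFunction (Φ.comp (inclusionVN G))

end Fourier

section Arens
variable {A : Type*} [NonUnitalNormedRing A] [NormedSpace ℂ A] [IsScalarTower ℂ A A]
  [SMulCommClass ℂ A A]

/-- The right action of `A` on `A'`: `⟨f · a, b⟩ = ⟨f, a b⟩`. -/
def arensRight (f : StrongDual ℂ A) : A →L[ℂ] StrongDual ℂ A :=
  (ContinuousLinearMap.compL ℂ A A ℂ f).comp (ContinuousLinearMap.mul ℂ A)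

theorem arensRight_apply (f : StrongDual ℂ A) (a b : A) : arensRight f a b = f (a * b) := rfl

/-- The left action of `A''` on `A'`: `⟨Ψ · f, a⟩ = ⟨Ψ, f · a⟩`. -/
def arensLeft (Ψ : StrongDual ℂ (StrongDual ℂ A)) : StrongDual ℂ A →L[ℂ] StrongDual ℂ A :=
  (ContinuousLinearMap.compL ℂ A (StrongDual ℂ A) ℂ Ψ).comp
    (((ContinuousLinearMap.compL ℂ A (A →L[ℂ] A) (StrongDual ℂ A)).flip
      (ContinuousLinearMap.mul ℂ A)).comp (ContinuousLinearMap.compL ℂ A A ℂ))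

theorem arensLeft_apply (Ψ : StrongDual ℂ (StrongDual ℂ A)) (f : StrongDual ℂ A) (a : A) :
    arensLeft Ψ f a = Ψ (arensRight f a) := rfl

/-- The first Arens product on `A''`: `⟨Φ □ Ψ, f⟩ = ⟨Φ, Ψ · f⟩`. -/
def arensProduct (Φ Ψ : StrongDual ℂ (StrongDual ℂ A)) : StrongDual ℂ (StrongDual ℂ A) :=
  Φ.comp (arensLeft Ψ)

/-- The topological centre of `A''`: all `Φ` for which `Ψ ↦ Φ □ Ψ` is weak*-continuous. -/
def topologicalCentre (A : Type*) [NonUnitalNormedRing A] [NormedSpace ℂ A]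
    [IsScalarTower ℂ A A] [SMulCommClass ℂ A A] :
    Set (StrongDual ℂ (StrongDual ℂ A)) :=
  {Φ | Continuous fun Ψ : WeakDual ℂ (StrongDual ℂ A) =>
    StrongDual.toWeakDual (arensProduct Φ (WeakDual.toStrongDual Ψ))}

/-- `A` has an approximate identity which is bounded in the multiplier norm, that is, the norm of
the multiplication operators `a ↦ u a` on `A`. -/
def HasMultiplierBoundedApproximateIdentity (A : Type*) [NonUnitalNormedRing A] [NormedSpace ℂ A]
    [IsScalarTower ℂ A A] [SMulCommClass ℂ A A] :
    Prop :=
  ∃ (l : Filter A) (C : ℝ), l.IsApproximateUnit ∧ ∀ᶠ u in l, ‖ContinuousLinearMap.mul ℂ A u‖ ≤ C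

end Arens

/-- `T : E → F` is weakly compact: the image of the closed unit ball of `E` is relatively compact in
the weak topology of `F`. -/
def IsWeaklyCompactOperator {E F : Type*} [NormedAddCommGroup E] [NormedSpace ℂ E]
    [NormedAddCommGroup F] [NormedSpace ℂ F] (T : E →L[ℂ] F) : Prop :=
  IsCompact (closure ((fun x => toWeakSpace ℂ F (T x)) '' Metric.closedBall 0 1))

end FourierBidual

end

open Filter Topology
open scoped ComplexConjugate InnerProductSpace ENNReal

noncomputable section

/-! Write `L_φ` for `mulBy φ` on `A(G)` and `M_φ` for `multiplier φ` on `C*_ρ(G)`; the adjoint of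
`L_φ` extends `M_φ` to `VN(G)`. Point masses span a dense subspace of `A(G)`, and `T · δ_g = T(δ_g)
ρ(g)`. Hence `A' · A` lies in `C*_ρ(G)`, and `Ψ · T = T ∘ L_ψ` depends on `Ψ` only through `ψ =
p(Ψ)` (`arensLeft_eq`).

Let `Φ` be in the topological centre and `φ = p(Φ)`. Weak*-continuity forces `(Φ □ Ψ)(T) = Ψ(T ∘
L_φ)`. This vanishes when `Ψ` kills `C*_ρ(G)`, so by Hahn–Banach `T ∘ L_φ` lies in `C*_ρ(G)` for
every `T` in `VN(G)` (`comp_mulBy_mem_range`). The main point is that then `φψ` is in `A(G)` for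
every `ψ` in `C*_ρ(G)'` (`mulDual_mem_fourierSubmodule`). With it, the second adjoint of `L_φ` takes
values in `A(G)`, which is weak compactness.

To see that `φψ = ψ ∘ M_φ` is in `A(G)`, it is shown that `M_φ S` is small in norm when `‖S‖ ≤ 1`
and the trace norm `‖S δ_1‖` is small; such a functional is a norm limit of functionals of the form
`S ↦ ⟨S δ_1, y⟩`. The smallness comes from Baire's theorem: on a weak*-compact set of operators
supported on a countable subgroup, `T ↦ T ∘ L_φ` has values in a separable space, so it is almost
constant on some relatively weak*-open set. A cutoff `d` built from `S` (`exists_cutoff`) places two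
operators in this set whose difference is nearly `S`.

Conversely, if `L_φ` is weakly compact, a weak* cluster point `Φ` of `(φ u_α)` satisfies `p(Φ) = φ`,
and `(Φ □ Ψ)(T) = Ψ(T ∘ L_φ)` because the functional `T ↦ Ψ(T ∘ L_φ)` is evaluation at an element of
`A(G)`. Although `(u_α)` may be unbounded in norm, `(φ u_α)` is bounded: `φ u_α = φ ∘ M_{u_α}`. -/

namespace FourierBidual

/-! ### Banach space duality: Goldstine, Gantmacher, and approximation of functionals -/

section BanachSpaces
variable {E F : Type*} [NormedAddCommGroup E] [NormedSpace ℂ E]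
  [NormedAddCommGroup F] [NormedSpace ℂ F]

theorem mem_of_forall_dual_eq_zero (p : Submodule ℂ E) (hp : IsClosed (p : Set E)) {x : E}
    (h : ∀ f : StrongDual ℂ E, (∀ y ∈ p, f y = 0) → f x = 0) : x ∈ p := by
  by_contra hx
  have hne : p.mkQ x ≠ 0 := by simpa using hx
  have : IsClosed (p : Set E) := hp
  obtain ⟨f, hf⟩ := SeparatingDual.exists_ne_zero (R := ℂ) hne
  exact hf (h (f.comp p.mkQL) fun y hy => by
    have : p.mkQ y = 0 := by simpa using hy
    change f (p.mkQ y) = 0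
    rw [this, map_zero])

theorem exists_eval_of_continuous (f : WeakDual ℂ E →L[ℂ] ℂ) :
    ∃ x : E, ∀ ψ : StrongDual ℂ E, f (StrongDual.toWeakDual ψ) = ψ x := by
  obtain ⟨x, hx⟩ := LinearMap.dualEmbedding_surjective (topDualPairing ℂ E) f
  exact ⟨x, fun ψ => by rw [← hx]; rfl⟩

instance : IsScalarTower ℝ ℂ (WeakDual ℂ E) :=
  ⟨fun a b ψ => DFunLike.ext _ _ fun x => smul_assoc a b (ψ x)⟩

instance : LocallyConvexSpace ℝ (WeakDual ℂ E) :=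
  LocallyConvexSpace.induced (F := E → ℂ)
    { toFun := fun (ψ : WeakDual ℂ E) x => ψ x
      map_add' := fun _ _ => rfl
      map_smul' := fun _ _ => rfl }

/-- Goldstine's theorem. -/
theorem mem_closure_image_closedBall {Ψ : StrongDual ℂ (StrongDual ℂ E)} (hΨ : ‖Ψ‖ ≤ 1) :
    StrongDual.toWeakDual Ψ ∈ closure ((fun x : E => StrongDual.toWeakDual
      (NormedSpace.inclusionInDoubleDual ℂ E x)) '' Metric.closedBall 0 1) := by
  by_contra hn
  have hconv : Convex ℝ ((fun x : E => StrongDual.toWeakDual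
      (NormedSpace.inclusionInDoubleDual ℂ E x)) '' Metric.closedBall 0 1) := by
    rintro _ ⟨x, hx, rfl⟩ _ ⟨y, hy, rfl⟩ a b ha hb hab
    rw [mem_closedBall_zero_iff] at hx hy
    refine ⟨(a : ℂ) • x + (b : ℂ) • y, mem_closedBall_zero_iff.mpr ?_, DFunLike.ext _ _ fun T => ?_⟩
    · refine (norm_add_le _ _).trans ?_
      rw [norm_smul, norm_smul, Complex.norm_real, Complex.norm_real, Real.norm_of_nonneg ha,
        Real.norm_of_nonneg hb]
      nlinarith
    · change T ((a : ℂ) • x + (b : ℂ) • y) = a • T x + b • T y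
      simp
  obtain ⟨f, u, hf1, hf2⟩ := RCLike.geometric_hahn_banach_closed_point (𝕜 := ℂ)
    hconv.closure isClosed_closure hn
  obtain ⟨T, hT⟩ := exists_eval_of_continuous f
  rw [hT] at hf2
  have h1 : ∀ x : E, ‖x‖ ≤ 1 → (T x).re < u := by
    intro x hx
    have := hf1 _ (subset_closure ⟨x, by simpa using hx, rfl⟩)
    rw [hT] at this
    exact this
  have hu : 0 < u := by simpa using h1 0 (by simp)
  have h2 : ‖T‖ ≤ u := by
    refine ContinuousLinearMap.opNorm_le_bound _ hu.le fun x => ?_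
    by_cases h0 : T x = 0
    · rw [h0, norm_zero]; positivity
    have hx : 0 < ‖x‖ := norm_pos_iff.mpr fun h => h0 (by rw [h, map_zero])
    -- The scalar rotates and normalises `x`, so that `T` takes the real value `‖T x‖ / ‖x‖` there.
    have h3 := h1 ((conj (T x) / (‖T x‖ * ‖x‖)) • x) (by
      rw [norm_smul]
      simp [field])
    rw [map_smul, smul_eq_mul, div_mul_eq_mul_div, Complex.conj_mul'] at h3
    have h4 : ((‖T x‖ : ℂ) ^ 2 / (‖T x‖ * ‖x‖)) = ((‖T x‖ / ‖x‖ : ℝ) : ℂ) := by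
      have : ‖T x‖ ≠ 0 := by simpa using h0
      push_cast
      field_simp
    rw [h4, Complex.ofReal_re, div_lt_iff₀ hx] at h3
    exact h3.le
  have h3 : (Ψ T).re ≤ u := (Complex.re_le_norm _).trans ((Ψ.le_opNorm T).trans
    ((mul_le_of_le_one_left (norm_nonneg _) hΨ).trans h2))
  exact absurd hf2 (not_lt.mpr h3)

theorem continuous_toWeakDual_comp (R : F →L[ℂ] E) :
    Continuous fun Ψ : WeakDual ℂ E =>
      StrongDual.toWeakDual ((WeakDual.toStrongDual Ψ).comp R) :=
  WeakDual.continuous_of_continuous_eval fun y => WeakDual.eval_continuous (R y)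

theorem toWeakDual_mem_closedBall {ψ : StrongDual ℂ E} {r : ℝ} :
    StrongDual.toWeakDual ψ ∈ WeakDual.toStrongDual ⁻¹' Metric.closedBall (0 : StrongDual ℂ E) r ↔
      ‖ψ‖ ≤ r :=
  mem_closedBall_zero_iff (a := ψ)

/-- A bounded family of operators is equicontinuous, so convergence need only be checked on a set
with dense span. -/
theorem isClosed_setOf_tendsto {ι : Type*} {l : Filter ι} {f : ι → E →L[ℂ] F} {f₀ : E →L[ℂ] F}
    {C : ℝ} (hC : ∀ᶠ i in l, ‖f i‖ ≤ C) : IsClosed {x | Tendsto (fun i => f i x) l (𝓝 (f₀ x))} := by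
  refine isClosed_of_closure_subset fun x hx => Metric.tendsto_nhds.mpr fun ε hε => ?_
  set c := max C 0 + ‖f₀‖ + 1 with hc
  have hc0 : 0 < c := by positivity
  obtain ⟨y, hy, hxy⟩ := Metric.mem_closure_iff.mp hx (ε / c) (div_pos hε hc0)
  filter_upwards [hC, Metric.tendsto_nhds.mp hy (ε / c) (div_pos hε hc0)] with i hi1 hi2
  have h1 : dist (f i x) (f i y) ≤ max C 0 * (ε / c) := by
    rw [dist_eq_norm, ← map_sub]
    refine (ContinuousLinearMap.le_opNorm _ _).trans ?_
    rw [← dist_eq_norm]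
    gcongr
    exact hi1.trans (le_max_left _ _)
  have h2 : dist (f₀ y) (f₀ x) ≤ ‖f₀‖ * (ε / c) := by
    rw [dist_eq_norm, ← map_sub]
    refine (ContinuousLinearMap.le_opNorm _ _).trans ?_
    rw [← dist_eq_norm, dist_comm]
    gcongr
  calc _ ≤ _ := dist_triangle4 _ (f i y) (f₀ y) _
    _ < max C 0 * (ε / c) + ε / c + ‖f₀‖ * (ε / c) :=
      add_lt_add_of_lt_of_le (add_lt_add_of_le_of_lt h1 hi2) h2
    _ = ε := by rw [hc]; field_simp; ring

/-- The adjoint `T ↦ T ∘ L` of `L`. -/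
def precomp (L : E →L[ℂ] F) : StrongDual ℂ F →L[ℂ] StrongDual ℂ E :=
  (ContinuousLinearMap.compL ℂ E F ℂ).flip L

@[simp] theorem precomp_apply (L : E →L[ℂ] F) (T : StrongDual ℂ F) : precomp L T = T.comp L := rfl

/-- One half of Gantmacher's theorem. The second adjoint maps the weak*-compact ball of `E''` onto a
weak*-compact set; by hypothesis this set lies in `F`, where the weak* topology induces the weak
topology. -/
theorem isWeaklyCompactOperator_of_forall (L : E →L[ℂ] F)
    (h : ∀ Ψ : StrongDual ℂ (StrongDual ℂ E), ∃ y : F, ∀ T : StrongDual ℂ F, Ψ (T.comp L) = T y) :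
    IsWeaklyCompactOperator L := by
  refine NormedSpace.isCompact_closure_of_isBounded ℂ F _ ?_ ?_
  · refine (L.lipschitz.isBounded_image (Metric.isBounded_closedBall (x := (0 : E)) (r := 1))).subset ?_
    intro _ ⟨x, hx, h⟩
    exact ⟨x, hx, (toWeakSpace ℂ F).injective h⟩
  · have hK := (WeakDual.isCompact_closedBall (𝕜 := ℂ) (E := StrongDual ℂ E) 0 1).image
      (continuous_toWeakDual_comp (precomp L))
    refine (closure_minimal ?_ hK.isClosed).trans ?_
    · rintro _ ⟨_, ⟨x, hx, rfl⟩, rfl⟩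
      refine ⟨StrongDual.toWeakDual (NormedSpace.inclusionInDoubleDual ℂ E x),
        toWeakDual_mem_closedBall.mpr ?_, rfl⟩
      exact (NormedSpace.double_dual_bound ℂ E x).trans (mem_closedBall_zero_iff.mp hx)
    · rintro _ ⟨Ψ, -, rfl⟩
      obtain ⟨y, hy⟩ := h (WeakDual.toStrongDual Ψ)
      refine ⟨toWeakSpace ℂ F y, ?_⟩
      refine DFunLike.ext _ _ fun T => ?_
      exact (hy T).symm

/-- The other half of Gantmacher's theorem: by Goldstine, the second adjoint sends the ball of `E''`
into the weak* closure of the image of the ball of `E`, and this closure stays in `F` by weak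
compactness. -/
theorem IsWeaklyCompactOperator.exists_eq {L : E →L[ℂ] F} (hL : IsWeaklyCompactOperator L)
    (Ψ : StrongDual ℂ (StrongDual ℂ E)) :
    ∃ y : F, ∀ T : StrongDual ℂ F, Ψ (T.comp L) = T y := by
  have key : ∀ Ψ : StrongDual ℂ (StrongDual ℂ E), ‖Ψ‖ ≤ 1 →
      ∃ y : F, ∀ T : StrongDual ℂ F, Ψ (T.comp L) = T y := by
    intro Ψ hΨ
    have h1 := (continuous_toWeakDual_comp (precomp L)).continuousAt.continuousWithinAt.mem_closure_image
      (mem_closure_image_closedBall hΨ)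
    have hK := (hL.image (NormedSpace.inclusionInDoubleDualWeak ℂ F).continuous).isClosed
    have h2 := closure_minimal ?_ hK h1
    · obtain ⟨y, -, hy⟩ := h2
      refine ⟨(toWeakSpace ℂ F).symm y, fun T => ?_⟩
      exact (DFunLike.congr_fun hy T).symm
    · rintro _ ⟨_, ⟨x, hx, rfl⟩, rfl⟩
      exact ⟨toWeakSpace ℂ F (L x), subset_closure ⟨x, hx, rfl⟩, rfl⟩
  have hr : 0 < ‖Ψ‖ + 1 := by positivity
  have hr' : ((‖Ψ‖ + 1 : ℝ) : ℂ) ≠ 0 := by exact_mod_cast hr.ne'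
  obtain ⟨y, hy⟩ := key (((‖Ψ‖ + 1 : ℝ) : ℂ)⁻¹ • Ψ) (by
    refine ContinuousLinearMap.opNorm_le_bound _ zero_le_one fun T => ?_
    rw [_root_.smul_apply, norm_smul, norm_inv, Complex.norm_real, Real.norm_of_nonneg hr.le,
      inv_mul_le_iff₀ hr, one_mul]
    refine (Ψ.le_opNorm T).trans (mul_le_mul_of_nonneg_right ?_ (norm_nonneg _))
    linarith)
  refine ⟨((‖Ψ‖ + 1 : ℝ) : ℂ) • y, fun T => ?_⟩
  rw [map_smul, ← hy, _root_.smul_apply, smul_smul, mul_inv_cancel₀ hr', one_smul]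

/-- A functional on `E` which is continuous on the unit ball for the seminorm `‖D ·‖` can be
approximated in norm by functionals which factor through `D`. -/
theorem exists_norm_sub_comp_le (D : E →L[ℂ] F) (θ : StrongDual ℂ E)
    (h : ∀ ε > 0, ∃ δ > 0, ∀ x, ‖x‖ ≤ 1 → ‖D x‖ ≤ δ → ‖θ x‖ ≤ ε) {ε : ℝ} (hε : 0 < ε) :
    ∃ y : StrongDual ℂ F, ‖θ - y.comp D‖ ≤ ε := by
  obtain ⟨δ, hδ, hx⟩ := h (ε / 2) (by positivity)
  -- For a unit vector either `‖D x‖ ≤ δ`, and the hypothesis applies, or `‖θ‖ ≤ K * ‖D x‖`.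
  set K := ‖θ‖ / δ with hK
  have hb : ∀ x, ‖θ x‖ ≤ ε / 2 * ‖x‖ + K * ‖D x‖ := by
    have h1 : ∀ x, ‖x‖ = 1 → ‖θ x‖ ≤ ε / 2 + K * ‖D x‖ := by
      intro x hx1
      by_cases hD : ‖D x‖ ≤ δ
      · have : 0 ≤ K * ‖D x‖ := by positivity
        linarith [hx x hx1.le hD]
      · have h2 : ‖θ x‖ ≤ ‖θ‖ := by simpa [hx1] using θ.le_opNorm x
        have h3 : ‖θ‖ ≤ K * ‖D x‖ := by
          rw [hK, div_mul_eq_mul_div, le_div_iff₀ hδ]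
          exact mul_le_mul_of_nonneg_left (not_le.mp hD).le (norm_nonneg _)
        linarith
    intro x
    by_cases h0 : x = 0
    · simp [h0]
    · have hn : 0 < ‖x‖ := norm_pos_iff.mpr h0
      have h2 := h1 ((‖x‖⁻¹ : ℂ) • x) (by
        rw [norm_smul]; simp [hn.ne'])
      rw [map_smul, map_smul, norm_smul, norm_smul] at h2
      simp only [norm_inv, Complex.norm_real, norm_norm] at h2
      rw [inv_mul_le_iff₀ hn] at h2
      calc _ ≤ _ := h2
        _ = _ := by field_simp
  -- The bound `hb` makes `θ` a functional of norm at most 2 on the range of `J`; the 2 compares a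
  -- sum with the maximum norm. Extended by Hahn–Banach to `E × F`, its second component factors
  -- through `D` and its first component has norm at most `ε`.
  let J : E →L[ℂ] E × F := (((ε : ℂ) / 2) • ContinuousLinearMap.id ℂ E).prod ((K : ℂ) • D)
  have hJb : ∀ x, ‖θ x‖ ≤ 2 * ‖J x‖ := by
    intro x
    have h1 : ‖(J x).1‖ = ε / 2 * ‖x‖ := by
      simp [J, norm_smul, abs_of_pos hε]
    have h2 : ‖(J x).2‖ = K * ‖D x‖ := by
      have : 0 ≤ K := by positivity
      simp [J, norm_smul, abs_of_nonneg this]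
    have := hb x
    linarith [norm_fst_le (J x), norm_snd_le (J x)]
  let e := J.toLinearMap.rangeRestrict
  have he : DenseRange e := J.toLinearMap.surjective_rangeRestrict.denseRange
  have hJ' : ∀ x, ‖θ.toLinearMap x‖ ≤ 2 * ‖e x‖ := hJb
  obtain ⟨g, hg1, hg2⟩ := exists_extension_norm_eq J.toLinearMap.range
    (θ.toLinearMap.extendOfNorm e)
  have hg3 : ∀ x, g (J x) = θ x := fun x =>
    (hg1 (e x)).trans (LinearMap.extendOfNorm_eq he ⟨2, hJ'⟩ x)
  have hg4 : ‖g‖ ≤ 2 := hg2.trans_le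
    (LinearMap.opNorm_extendOfNorm_le he zero_le_two hJ')
  refine ⟨(g.comp (ContinuousLinearMap.inr ℂ E F)).comp ((K : ℂ) • ContinuousLinearMap.id ℂ F),
    ContinuousLinearMap.opNorm_le_bound _ hε.le fun x => ?_⟩
  have h1 : (θ - ((g.comp (ContinuousLinearMap.inr ℂ E F)).comp
      ((K : ℂ) • ContinuousLinearMap.id ℂ F)).comp D) x = g (((ε : ℂ) / 2) • x, 0) := by
    have h2 : J x = (((ε : ℂ) / 2) • x, 0) + (0, (K : ℂ) • D x) := by
      simp [J]
    rw [sub_apply, ← hg3, h2, map_add, ContinuousLinearMap.comp_apply, ContinuousLinearMap.comp_apply]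
    exact add_sub_cancel_right _ _
  rw [h1]
  refine (g.le_opNorm _).trans ?_
  have h2 : ‖((((ε : ℂ) / 2) • x, 0) : E × F)‖ = ε / 2 * ‖x‖ := by
    rw [Prod.norm_def, norm_zero, max_eq_left (norm_nonneg _), norm_smul]
    simp [abs_of_pos hε]
  rw [h2]
  calc _ ≤ 2 * (ε / 2 * ‖x‖) := by gcongr
    _ = _ := by ring

end BanachSpaces

/-! ### Point masses in `A(G)` and their density -/

section PointMasses
variable {G : Type*}

theorem delta_apply_self (a : G) : delta a a = 1 := by
  classical exact lp.single_apply_self (E := fun _ : G => ℂ) 2 a (1 : ℂ)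

theorem delta_apply_of_ne {a g : G} (h : g ≠ a) : delta a g = 0 := by
  classical exact lp.single_apply_ne (E := fun _ : G => ℂ) 2 a (1 : ℂ) h

theorem inner_delta_left (g : G) (x : ell2 G) : ⟪delta g, x⟫_ℂ = x g := by
  classical
  refine (lp.inner_single_left (𝕜 := ℂ) (G := fun _ : G => ℂ) g (1 : ℂ) x).trans ?_
  rw [RCLike.inner_apply, map_one, mul_one]
  rfl

variable [Group G]

theorem toFunction_coeff_delta_self (a b : G) :
    toFunction (coeffFunctional (delta a) (delta b)) (b * a⁻¹) = 1 := by
  change ⟪delta b, leftReg (b * a⁻¹) (delta a)⟫_ℂ = 1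
  rw [inner_delta_left, leftReg_apply]
  simp [delta_apply_self]

theorem toFunction_coeff_delta_of_ne {a b g : G} (h : g ≠ b * a⁻¹) :
    toFunction (coeffFunctional (delta a) (delta b)) g = 0 := by
  change ⟪delta b, leftReg g (delta a)⟫_ℂ = 0
  rw [inner_delta_left, leftReg_apply]
  exact delta_apply_of_ne fun h' => h (by rw [← h']; simp)

/-- Both sides are the indicator function of `{b * a⁻¹}`. This expresses that operators in `C*_ρ(G)`
commute with right translations. -/
theorem coeff_delta (a b : G) :
    coeffFunctional (delta a) (delta b) = coeffFunctional (delta 1) (delta (b * a⁻¹)) := by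
  refine toFunction_injective (funext fun g => ?_)
  by_cases hg : g = b * a⁻¹
  · rw [hg, toFunction_coeff_delta_self]
    simpa using (toFunction_coeff_delta_self 1 (b * a⁻¹)).symm
  · rw [toFunction_coeff_delta_of_ne hg, toFunction_coeff_delta_of_ne (by simpa using hg)]

/-- The indicator function of `{g}` as an element of `A(G)`. -/
def pointMass (g : G) : FourierAlgebra G :=
  ⟨coeffFunctional (delta 1) (delta g), coeffFunctional_mem _ _⟩

theorem pointMass_apply_self (g : G) : pointMass g g = 1 := by
  have h := toFunction_coeff_delta_self 1 g
  rwa [inv_one, mul_one] at h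

theorem pointMass_apply_of_ne {g h : G} (hh : h ≠ g) : pointMass g h = 0 :=
  toFunction_coeff_delta_of_ne (a := 1) (b := g) (by simpa using hh)

theorem pointMass_mul (g : G) (u : FourierAlgebra G) : pointMass g * u = u g • pointMass g := by
  refine fourier_ext fun h => ?_
  rw [mul_apply, smul_apply]
  by_cases hh : h = g
  · rw [hh, mul_comm]
  · rw [pointMass_apply_of_ne hh, zero_mul, mul_zero]

theorem toDual_pointMass_apply (g : G) (S : ReducedCstar G) :
    toDual (pointMass g) S = toOperator S (delta 1) g :=
  inner_delta_left g _

theorem toOperator_delta (S : ReducedCstar G) (a b : G) :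
    toOperator S (delta a) b = toOperator S (delta 1) (b * a⁻¹) := by
  have h := DFunLike.congr_fun (coeff_delta a b) S
  rwa [coeffFunctional_apply, coeffFunctional_apply, inner_delta_left, inner_delta_left] at h

/-- The coefficients of pairs of unit vectors are point masses, and `coeffFunctional` is continuous
and linear in one variable, conjugate linear in the other. So the closed span of the point masses
contains all coefficients. -/
theorem fourier_mem_of_pointMass (p : Submodule ℂ (FourierAlgebra G))
    (hp : IsClosed (p : Set (FourierAlgebra G))) (h : ∀ g, pointMass g ∈ p)
    (u : FourierAlgebra G) : u ∈ p := by
  have hA : IsClosed (fourierSubmodule G : Set (StrongDual ℂ (ReducedCstar G))) :=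
    Submodule.isClosed_topologicalClosure _
  let q : Submodule ℂ (StrongDual ℂ (ReducedCstar G)) := p.map (fourierSubmodule G).subtype
  have hq : IsClosed (q : Set (StrongDual ℂ (ReducedCstar G))) :=
    hA.isClosedEmbedding_subtypeVal.isClosedMap _ hp
  let S (y : ell2 G) : Submodule ℂ (ell2 G) :=
    q.comap (σ₁₂ := RingHom.id ℂ)
      { toFun := fun x => coeffFunctional x y
        map_add' := fun x x' => by ext T; simp
        map_smul' := fun c x => by ext T; simp }
  let R (x : ell2 G) : Submodule ℂ (ell2 G) :=
    q.comap (σ₁₂ := starRingEnd ℂ)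
      { toFun := fun y => coeffFunctional x y
        map_add' := fun y y' => by ext T; simp
        map_smul' := fun c y => by ext T; simp [mul_comm] }
  have hS : ∀ y, IsClosed (S y : Set (ell2 G)) := fun y =>
    hq.preimage (continuous_coeffFunctional.comp (continuous_id.prodMk continuous_const))
  have hR : ∀ x, IsClosed (R x : Set (ell2 G)) := fun x =>
    hq.preimage (continuous_coeffFunctional.comp (continuous_const.prodMk continuous_id))
  have h1 : fourierSubmodule G ≤ q := by
    refine Submodule.topologicalClosure_minimal _ (Submodule.span_le.mpr ?_) hq
    rintro _ ⟨x, y, rfl⟩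
    refine ell2_mem_of_delta (R x) (hR x) (fun b => ?_) y
    refine ell2_mem_of_delta (S (delta b)) (hS _) (fun a => ?_) x
    exact ⟨pointMass (b * a⁻¹), h _, (coeff_delta a b).symm⟩
  obtain ⟨w, hw, hwu⟩ := h1 u.2
  have : w = u := Subtype.val_injective hwu
  exact this ▸ hw

theorem fourier_hom_ext {F : Type*} [NormedAddCommGroup F] [NormedSpace ℂ F]
    {S T : FourierAlgebra G →L[ℂ] F} (h : ∀ g, S (pointMass g) = T (pointMass g)) : S = T := by
  refine ContinuousLinearMap.ext fun u => ?_
  exact fourier_mem_of_pointMass (LinearMap.eqLocus S.toLinearMap T.toLinearMap)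
    (isClosed_eq S.continuous T.continuous) h u

end PointMasses

/-! ### Multiplication by functionals and the module actions on `VN(G)` -/

section Multiplication
variable {G : Type*} [Group G]

theorem mulDual_comm (φ ψ : StrongDual ℂ (ReducedCstar G)) : mulDual φ ψ = mulDual ψ φ :=
  toFunction_injective (funext fun g => by
    rw [toFunction_mulDual, toFunction_mulDual, mul_comm])

/-- Multiplication of elements of `A(G)` with the function given by a functional on `C*_ρ(G)`. -/
def mulBy (φ : StrongDual ℂ (ReducedCstar G)) : FourierAlgebra G →L[ℂ] FourierAlgebra G :=
  ContinuousLinearMap.codRestrict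
    (((ContinuousLinearMap.compL ℂ (ReducedCstar G) (ReducedCstar G) ℂ).flip
      (multiplier φ)).comp toDual)
    (fourierSubmodule G) fun u => mulDual_mem _ u.2

theorem toDual_mulBy (φ : StrongDual ℂ (ReducedCstar G)) (u : FourierAlgebra G) :
    toDual (mulBy φ u) = mulDual φ (toDual u) := rfl

theorem mulBy_apply (φ : StrongDual ℂ (ReducedCstar G)) (u : FourierAlgebra G) (g : G) :
    mulBy φ u g = toFunction φ g * u g :=
  toFunction_mulDual φ (toDual u) g

/-- `mulOperator` is defined through a chosen functional; this frees it from the choice. -/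
theorem mulOperator_eq_mulBy (v : reducedFourierStieltjes G)
    {φ : StrongDual ℂ (ReducedCstar G)} (h : toFunction φ = v.1) : mulOperator v = mulBy φ :=
  ContinuousLinearMap.ext fun u => fourier_ext fun g => by
    rw [mulOperator_apply, mulBy_apply, h]

theorem mulBy_pointMass (φ : StrongDual ℂ (ReducedCstar G)) (g : G) :
    mulBy φ (pointMass g) = toFunction φ g • pointMass g := by
  refine fourier_ext fun h => ?_
  rw [mulBy_apply, smul_apply]
  by_cases hh : h = g
  · rw [hh]
  · rw [pointMass_apply_of_ne hh, mul_zero, mul_zero]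

theorem inclusionVN_apply (S : ReducedCstar G) (u : FourierAlgebra G) :
    inclusionVN G S u = toDual u S := rfl

theorem norm_coeffFunctional_le (x y : ell2 G) : ‖coeffFunctional x y‖ ≤ ‖x‖ * ‖y‖ := by
  refine ContinuousLinearMap.opNorm_le_bound _ (by positivity) fun T => ?_
  rw [coeffFunctional_apply]
  calc _ ≤ ‖y‖ * ‖toOperator T x‖ := norm_inner_le_norm _ _
    _ ≤ ‖y‖ * (‖T‖ * ‖x‖) := by
      gcongr
      exact (toOperator T).le_opNorm x
    _ = _ := by ring

theorem norm_inclusionVN (S : ReducedCstar G) : ‖inclusionVN G S‖ = ‖S‖ := by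
  refine le_antisymm ?_ ?_
  · refine ContinuousLinearMap.opNorm_le_bound _ (norm_nonneg _) fun u => ?_
    rw [inclusionVN_apply, mul_comm]
    exact (toDual u).le_opNorm S
  · rw [← norm_toOperator]
    refine opNorm_le_of_inner (norm_nonneg _) fun x y => ?_
    rw [← inclusionVN_coeff, mul_assoc]
    refine ((inclusionVN G S).le_opNorm _).trans ?_
    gcongr
    exact norm_coeffFunctional_le x y

theorem isClosed_range_inclusionVN :
    IsClosed ((inclusionVN G).range : Set (StrongDual ℂ (FourierAlgebra G))) := by
  have h : Isometry (inclusionVN G) := AddMonoidHomClass.isometry_of_norm _ norm_inclusionVN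
  exact h.isClosedEmbedding.isClosed_range

theorem inclusionVN_injective : Function.Injective (inclusionVN G) :=
  (AddMonoidHomClass.isometry_of_norm _ norm_inclusionVN).injective

/-- The multiplier on `C*_ρ(G)` is a restriction of the adjoint of multiplication on `A(G)`. Thus it
is controlled by the multiplier norm of `u`, not merely by the possibly larger `‖u‖`. -/
theorem norm_multiplier_toDual_le (u : FourierAlgebra G) :
    ‖multiplier (toDual u)‖ ≤ ‖ContinuousLinearMap.mul ℂ (FourierAlgebra G) u‖ := by
  refine ContinuousLinearMap.opNorm_le_bound _ (norm_nonneg _) fun S => ?_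
  have h : inclusionVN G (multiplier (toDual u) S) =
      (inclusionVN G S).comp (ContinuousLinearMap.mul ℂ (FourierAlgebra G) u) := rfl
  rw [← norm_inclusionVN, h, mul_comm, ← norm_inclusionVN S]
  exact ContinuousLinearMap.opNorm_comp_le _ _

theorem arensRight_pointMass (T : StrongDual ℂ (FourierAlgebra G)) (g : G) :
    arensRight T (pointMass g) = T (pointMass g) • inclusionVN G (rho g) := by
  refine ContinuousLinearMap.ext fun b => ?_
  rw [arensRight_apply, pointMass_mul, map_smul]
  exact mul_comm _ _

/-- On point masses the action gives multiples of `ρ(g)`; density and the closedness of `C*_ρ(G)` in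
`VN(G)` do the rest. -/
theorem arensRight_mem_range (T : StrongDual ℂ (FourierAlgebra G)) (u : FourierAlgebra G) :
    arensRight T u ∈ (inclusionVN G).range := by
  refine fourier_mem_of_pointMass ((inclusionVN G).range.comap (arensRight T).toLinearMap)
    (isClosed_range_inclusionVN.preimage (arensRight T).continuous) (fun g => ?_) u
  change arensRight T (pointMass g) ∈ (inclusionVN G).range
  rw [arensRight_pointMass]
  exact Submodule.smul_mem _ _ ⟨rho g, rfl⟩

theorem arensLeft_eq (Ψ : StrongDual ℂ (StrongDual ℂ (FourierAlgebra G)))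
    (T : StrongDual ℂ (FourierAlgebra G)) :
    arensLeft Ψ T = T.comp (mulBy (Ψ.comp (inclusionVN G))) := by
  refine fourier_hom_ext fun g => ?_
  rw [arensLeft_apply, arensRight_pointMass, map_smul, ContinuousLinearMap.comp_apply,
    mulBy_pointMass, map_smul]
  exact mul_comm _ _

end Multiplication

/-! ### Consequences of the multiplier-bounded approximate identity -/

section ApproximateIdentity
variable {G : Type*} [Group G] {l : Filter (FourierAlgebra G)} {C : ℝ}

theorem tendsto_coe_approximateUnit (hl : l.IsApproximateUnit) (g : G) :
    Tendsto (fun u : FourierAlgebra G => u g) l (𝓝 1) := by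
  have h1 := hl.tendsto_mul_left (pointMass g)
  have h2 := ((inclusionVN G (rho g)).continuous.tendsto _).comp h1
  have h3 : inclusionVN G (rho g) (pointMass g) = 1 := pointMass_apply_self g
  rw [h3] at h2
  refine h2.congr fun u => ?_
  change (pointMass g * u) g = u g
  rw [mul_apply, pointMass_apply_self, one_mul]

theorem tendsto_multiplier (hl : l.IsApproximateUnit)
    (hC : ∀ᶠ u in l, ‖ContinuousLinearMap.mul ℂ (FourierAlgebra G) u‖ ≤ C) (S : ReducedCstar G) :
    Tendsto (fun u => multiplier (toDual u) S) l (𝓝 S) := by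
  have hcl := isClosed_setOf_tendsto (f₀ := ContinuousLinearMap.id ℂ (ReducedCstar G))
    (hC.mono fun u hu => (norm_multiplier_toDual_le u).trans hu)
  refine hcl.closure_subset_iff.mpr ?_ (rhoSum_denseRange S)
  rintro _ ⟨f, rfl⟩
  change Tendsto _ _ (𝓝 (rhoSum f))
  simp only [rhoSum, Finsupp.linearCombination_apply, Finsupp.sum, map_sum, map_smul,
    multiplier_rho]
  refine tendsto_finsetSum _ fun g _ => ?_
  have := ((tendsto_coe_approximateUnit hl g).smul_const (rho g)).const_smul (f g)
  rwa [one_smul] at this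

/-- By commutativity the product is also `φ ∘ M_u`, which replaces `‖u‖` by the multiplier norm of
`u`. -/
theorem norm_mulBy_apply_le (φ : StrongDual ℂ (ReducedCstar G)) (u : FourierAlgebra G) :
    ‖mulBy φ u‖ ≤ ‖φ‖ * ‖ContinuousLinearMap.mul ℂ (FourierAlgebra G) u‖ := by
  rw [← norm_toDual, toDual_mulBy, mulDual_comm]
  refine (ContinuousLinearMap.opNorm_comp_le _ _).trans ?_
  gcongr
  exact norm_multiplier_toDual_le u

/-- The products of `φ` with the approximate identity form a bounded family in `A(G)` converging
pointwise to `φ`. -/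
theorem toFunction_mem_reducedFourierStieltjes (hl : l.IsApproximateUnit)
    (hC : ∀ᶠ u in l, ‖ContinuousLinearMap.mul ℂ (FourierAlgebra G) u‖ ≤ C)
    (φ : StrongDual ℂ (ReducedCstar G)) : toFunction φ ∈ reducedFourierStieltjes G := by
  have := hl.neBot
  have h : Tendsto (fun u => (mulBy φ u : G → ℂ)) l (𝓝 (toFunction φ)) := by
    refine tendsto_pi_nhds.mpr fun g => ?_
    have := (tendsto_coe_approximateUnit hl g).const_mul (toFunction φ g)
    rw [mul_one] at this
    exact this.congr fun u => (mulBy_apply φ u g).symm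
  refine ⟨‖φ‖ * C, mem_closure_of_tendsto h ?_⟩
  filter_upwards [hC] with u hu
  exact ⟨mulBy φ u, (norm_mulBy_apply_le φ u).trans (by gcongr), rfl⟩

end ApproximateIdentity

/-! ### Cutoff operators in C*-algebras -/

section Cutoff
variable {H : Type*} [NormedAddCommGroup H] [InnerProductSpace ℂ H] [CompleteSpace H]

theorem norm_add_I_smul_sq {S : H →L[ℂ] H} (hS : IsSelfAdjoint S) (η : ℝ) (x : H) :
    ‖S x + ((η : ℂ) * Complex.I) • x‖ ^ 2 = ‖S x‖ ^ 2 + η ^ 2 * ‖x‖ ^ 2 := by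
  have h1 : (⟪S x, x⟫_ℂ).im = 0 := by
    have h2 : conj ⟪S x, x⟫_ℂ = ⟪S x, x⟫_ℂ := by
      rw [inner_conj_symm, ← ContinuousLinearMap.adjoint_inner_left,
        ← ContinuousLinearMap.star_eq_adjoint, hS.star_eq]
    exact Complex.conj_eq_iff_im.mp h2
  rw [norm_add_sq (𝕜 := ℂ), inner_smul_right, norm_smul, norm_mul, Complex.norm_I,
    Complex.norm_real, mul_one, mul_pow, Real.norm_eq_abs, sq_abs]
  simp [h1]

/-- A self-adjoint operator `S` in a C*-algebra of operators has, up to an error of norm `η`, the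
form `d* S d`, where `d` in the algebra is small wherever `S` is small, and where `d* d` and
`(1 - d)* (1 - d)` add up to `1`. -/
theorem exists_cutoff (𝒩 : StarSubalgebra ℂ (H →L[ℂ] H))
    (hN : IsClosed (𝒩 : Set (H →L[ℂ] H))) {S : H →L[ℂ] H} (hS : IsSelfAdjoint S) (hSN : S ∈ 𝒩)
    {η : ℝ} (hη : 0 < η) :
    ∃ d ∈ 𝒩, (∀ x, ‖x - d x‖ ^ 2 + ‖d x‖ ^ 2 = ‖x‖ ^ 2) ∧ (∀ x, ‖d x‖ ≤ ‖S x‖ / η) ∧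
      ‖S - star d * S * d‖ ≤ η := by
  -- With `R = (S + iη)⁻¹`, the cutoff is `d = S R`, and `1 - d = iη R`. All norm bounds follow from
  -- `‖x‖² = ‖S R x‖² + η² ‖R x‖²`.
  set z : ℂ := (η : ℂ) * Complex.I with hz
  have hunit : IsUnit (S + algebraMap ℂ _ z) := by
    have h1 : -z ∉ spectrum ℂ S := fun h => by
      have := hS.im_eq_zero_of_mem_spectrum h
      simp [hz, hη.ne'] at this
    have h2 := spectrum.notMem_iff.mp h1
    have h3 : S + algebraMap ℂ _ z = -(algebraMap ℂ _ (-z) - S) := by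
      rw [map_neg]; abel
    rw [h3]
    exact h2.neg
  have haN : S + algebraMap ℂ _ z ∈ 𝒩 := add_mem hSN (𝒩.algebraMap_mem z)
  -- Spectral permanence: the inverse stays in the closed star subalgebra.
  obtain ⟨⟨⟨a, _⟩, ⟨R, hR⟩, hR1, hR2⟩, ha⟩ :=
    (StarSubalgebra.coe_isUnit 𝒩 (a := ⟨S + algebraMap ℂ _ z, haN⟩)).mp hunit
  have ha' : a = S + algebraMap ℂ _ z := congrArg Subtype.val ha
  replace hR1 : (S + algebraMap ℂ _ z) * R = 1 := by
    rw [← ha']; exact congrArg Subtype.val hR1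
  replace hR2 : R * (S + algebraMap ℂ _ z) = 1 := by
    rw [← ha']; exact congrArg Subtype.val hR2
  have hcomm : S * R = R * S := by
    rw [add_mul] at hR1
    rw [mul_add, ← Algebra.commutes] at hR2
    exact add_right_cancel (hR1.trans hR2.symm)
  have hRx : ∀ x, S (R x) + z • R x = x := fun x => by
    have := DFunLike.congr_fun hR1 x
    simpa [Algebra.algebraMap_eq_smul_one] using this
  have hsq : ∀ x, ‖x‖ ^ 2 = ‖S (R x)‖ ^ 2 + η ^ 2 * ‖R x‖ ^ 2 := fun x => by
    rw [← norm_add_I_smul_sq hS, hRx]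
  have hRn : ∀ x, ‖R x‖ ≤ ‖x‖ / η := fun x => by
    rw [le_div_iff₀ hη]
    refine le_of_sq_le_sq ?_ (norm_nonneg x)
    rw [hsq x, mul_pow]
    nlinarith [sq_nonneg ‖S (R x)‖]
  have hdn : ∀ x, ‖S (R x)‖ ≤ ‖x‖ := fun x => by
    refine le_of_sq_le_sq ?_ (norm_nonneg x)
    rw [hsq x]
    nlinarith [mul_nonneg (sq_nonneg η) (sq_nonneg ‖R x‖)]
  have hRnorm : ‖R‖ ≤ 1 / η :=
    R.opNorm_le_bound (by positivity) fun x => (hRn x).trans_eq (by ring)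
  have hdnorm : ‖S * R‖ ≤ 1 :=
    (S * R).opNorm_le_bound zero_le_one fun x => (hdn x).trans_eq (one_mul _).symm
  refine ⟨S * R, mul_mem hSN hR, fun x => ?_, fun x => ?_, ?_⟩
  · have h1 : x - (S * R) x = z • R x := by
      rw [sub_eq_iff_eq_add']
      exact (hRx x).symm
    rw [h1, norm_smul, hz, norm_mul, Complex.norm_I, mul_one, Complex.norm_real, mul_pow,
      Real.norm_eq_abs, sq_abs, hsq x, add_comm]
    rfl
  · rw [hcomm]
    exact hRn (S x)
  · have h1 : star R * (S - algebraMap ℂ _ z) = 1 := by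
      have := congrArg star hR1
      rw [star_mul, star_add, hS.star_eq, star_one, ← algebraMap_star_comm] at this
      rw [← this, hz]
      simp [sub_eq_add_neg]
    -- Since `R* (S - iη) = 1`, one has `S = R* (S² + η²) S R`, whose first summand is `d* S d`. The
    -- remainder has norm at most `η² · (1 / η) · 1 = η`.
    have h2 : S - star (S * R) * S * (S * R) = ((η : ℂ) ^ 2) • (star R * (S * R)) := by
      have h3 : (S - algebraMap ℂ _ z) * (S + algebraMap ℂ _ z) =
          S * S + ((η : ℂ) ^ 2) • 1 := by
        have hzz : -(z * z) = (η : ℂ) ^ 2 := by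
          rw [hz]
          linear_combination (-(η : ℂ) ^ 2) * Complex.I_mul_I
        rw [sub_mul, mul_add, mul_add, ← Algebra.commutes z S, ← map_mul,
          Algebra.algebraMap_eq_smul_one (z * z), ← hzz, neg_smul]
        abel
      have h4 : S = star R * ((S - algebraMap ℂ _ z) * (S + algebraMap ℂ _ z)) * (S * R) := by
        calc S = star R * (S - algebraMap ℂ _ z) * (S * ((S + algebraMap ℂ _ z) * R)) := by
              rw [h1, hR1, one_mul, mul_one]
          _ = star R * (S - algebraMap ℂ _ z) * ((S * (S + algebraMap ℂ _ z)) * R) := by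
              rw [mul_assoc S]
          _ = star R * (S - algebraMap ℂ _ z) * (((S + algebraMap ℂ _ z) * S) * R) := by
              rw [mul_add, add_mul S, Algebra.commutes]
          _ = _ := by simp only [mul_assoc]
      conv_lhs => enter [1]; rw [h4, h3]
      rw [star_mul, hS.star_eq, mul_add, add_mul, mul_smul_comm, mul_one, smul_mul_assoc]
      simp only [mul_assoc, add_sub_cancel_left]
    rw [h2, norm_smul, norm_pow, Complex.norm_real, Real.norm_of_nonneg hη.le]
    calc η ^ 2 * ‖star R * (S * R)‖ ≤ η ^ 2 * (1 / η * 1) := by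
          gcongr
          refine (norm_mul_le _ _).trans ?_
          rw [norm_star]
          gcongr
      _ = η := by field_simp

/-- Cauchy–Schwarz for the isometry `x ↦ (c x, d x)` of `H` into `H ⊕ H`. -/
theorem norm_sandwich_le {c d P Q : H →L[ℂ] H} (h : ∀ x, ‖c x‖ ^ 2 + ‖d x‖ ^ 2 = ‖x‖ ^ 2)
    (hP : ‖P‖ ≤ 1) (hQ : ‖Q‖ ≤ 1) : ‖star c * P * c + star d * Q * d‖ ≤ 1 := by
  refine ContinuousLinearMap.opNorm_le_of_re_inner_le (𝕜 := ℂ) zero_le_one fun x y hx hy => ?_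
  have h1 : ⟪(star c * P * c + star d * Q * d) x, y⟫_ℂ =
      ⟪P (c x), c y⟫_ℂ + ⟪Q (d x), d y⟫_ℂ := by
    rw [← ContinuousLinearMap.adjoint_inner_left, ← ContinuousLinearMap.adjoint_inner_left,
      ← inner_add_left]
    rfl
  have h2 : ∀ {T : H →L[ℂ] H} (_ : ‖T‖ ≤ 1) (u v : H), ‖⟪T u, v⟫_ℂ‖ ≤ ‖u‖ * ‖v‖ := by
    intro T hT u v
    refine (norm_inner_le_norm _ _).trans ?_
    gcongr
    exact (T.le_opNorm u).trans (mul_le_of_le_one_left (norm_nonneg _) hT)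
  have h3 := h x
  have h4 := h y
  rw [hx] at h3
  rw [hy] at h4
  rw [h1]
  have h5 : ‖⟪P (c x), c y⟫_ℂ + ⟪Q (d x), d y⟫_ℂ‖ ≤ ‖c x‖ * ‖c y‖ + ‖d x‖ * ‖d y‖ :=
    (norm_add_le _ _).trans (add_le_add (h2 hP _ _) (h2 hQ _ _))
  refine (Complex.re_le_norm _).trans (h5.trans ?_)
  nlinarith [sq_nonneg (‖c x‖ - ‖c y‖), sq_nonneg (‖d x‖ - ‖d y‖)]

end Cutoff

/-! ### Operators supported on a subgroup -/

section Support
variable {G : Type*}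

theorem continuous_apply_ell2 (x : ell2 G) (g : G) :
    Continuous fun T : ell2 G →L[ℂ] ell2 G => T x g := by
  simp only [← inner_delta_left]
  fun_prop

variable [Group G]

/-- The operators in `C*_ρ(G)` which, together with their adjoints, map functions supported in `H`
to functions supported in `H`. -/
def supportedSubalgebra (H : Subgroup G) : StarSubalgebra ℂ (ell2 G →L[ℂ] ell2 G) where
  carrier := {T | T ∈ reducedCstarSubalgebra G ∧ ∀ x : ell2 G, (∀ g ∉ H, x g = 0) →
    ∀ g ∉ H, T x g = 0 ∧ star T x g = 0}
  mul_mem' {S T} hS hT := ⟨mul_mem hS.1 hT.1, fun x hx g hg => by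
    rw [star_mul]
    exact ⟨(hS.2 _ (fun k hk => (hT.2 x hx k hk).1) g hg).1,
      (hT.2 _ (fun k hk => (hS.2 x hx k hk).2) g hg).2⟩⟩
  add_mem' {S T} hS hT := ⟨add_mem hS.1 hT.1, fun x hx g hg => by
    have h1 := hS.2 x hx g hg
    have h2 := hT.2 x hx g hg
    rw [star_add]
    constructor
    · change S x g + T x g = 0
      rw [h1.1, h2.1, add_zero]
    · change star S x g + star T x g = 0
      rw [h1.2, h2.2, add_zero]⟩
  algebraMap_mem' r := ⟨algebraMap_mem _ r, fun x hx g hg => by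
    rw [← algebraMap_star_comm]
    constructor
    · change r * x g = 0
      rw [hx g hg, mul_zero]
    · change star r * x g = 0
      rw [hx g hg, mul_zero]⟩
  star_mem' {T} hT := ⟨star_mem hT.1, fun x hx g hg => by
    rw [star_star]
    exact (hT.2 x hx g hg).symm⟩

theorem supportedSubalgebra_le (H : Subgroup G) :
    supportedSubalgebra H ≤ reducedCstarSubalgebra G := fun _ hT => hT.1

theorem isClosed_supportedSubalgebra (H : Subgroup G) :
    IsClosed (supportedSubalgebra H : Set (ell2 G →L[ℂ] ell2 G)) := by
  have h : (supportedSubalgebra H : Set (ell2 G →L[ℂ] ell2 G)) =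
      (reducedCstarSubalgebra G : Set (ell2 G →L[ℂ] ell2 G)) ∩
        ⋂ (x : ell2 G) (_ : ∀ g ∉ H, x g = 0) (g : G) (_ : g ∉ H),
          {T : ell2 G →L[ℂ] ell2 G | T x g = 0} ∩
            {T : ell2 G →L[ℂ] ell2 G | star T x g = 0} := by
    ext T
    simp only [Set.mem_inter_iff, Set.mem_iInter]
    rfl
  rw [h]
  refine (StarSubalgebra.isClosed_topologicalClosure _).inter
    (isClosed_iInter fun x => isClosed_iInter fun _ => isClosed_iInter fun g =>
      isClosed_iInter fun _ => (isClosed_eq (continuous_apply_ell2 x g) continuous_const).inter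
        (isClosed_eq ((continuous_apply_ell2 x g).comp continuous_star) continuous_const))

theorem leftReg_mem_supportedSubalgebra {H : Subgroup G} {h : G} (hh : h ∈ H) :
    leftReg h ∈ supportedSubalgebra H := by
  refine ⟨(rho h).2, fun x hx g hg => ?_⟩
  rw [leftReg_star, leftReg_apply, leftReg_apply, inv_inv]
  exact ⟨hx _ fun h' => hg ((H.mul_mem_cancel_left (H.inv_mem hh)).mp h'),
    hx _ fun h' => hg ((H.mul_mem_cancel_left hh).mp h')⟩

theorem apply_delta_one_eq_zero {H : Subgroup G} {T : ell2 G →L[ℂ] ell2 G}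
    (hT : T ∈ supportedSubalgebra H) {g : G} (hg : g ∉ H) : T (delta 1) g = 0 :=
  (hT.2 (delta 1) (fun _ hk => delta_apply_of_ne fun h => hk (h ▸ H.one_mem)) g hg).1

/-- Each `S n` is a norm limit of finite sums of `ρ(g)`, so only countably many `g` occur.
Countability later provides a separable target for Baire's theorem. -/
theorem exists_countable_subgroup (S : ℕ → ReducedCstar G) :
    ∃ H : Subgroup G, Countable H ∧ ∀ n, toOperator (S n) ∈ supportedSubalgebra H := by
  have h1 : ∀ n k : ℕ, ∃ f : G →₀ ℂ, dist (S n) (rhoSum f) < 1 / ((k : ℝ) + 1) := fun n k =>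
    rhoSum_denseRange.exists_dist_lt (S n) (by positivity)
  choose f hf using h1
  let D : Set G := ⋃ n, ⋃ k, (f n k).support
  have hD : D.Countable :=
    Set.countable_iUnion fun n => Set.countable_iUnion fun k => (f n k).support.countable_toSet
  have : Countable D := hD
  let H : Subgroup G := (FreeGroup.lift (Subtype.val : D → G)).range
  have hDH : ∀ g ∈ D, g ∈ H := fun g hg => ⟨FreeGroup.of ⟨g, hg⟩, by simp⟩
  refine ⟨H, (MonoidHom.rangeRestrict_surjective _).countable, fun n => ?_⟩
  have h2 : ∀ k, toOperator (rhoSum (f n k)) ∈ supportedSubalgebra H := by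
    intro k
    rw [rhoSum_coe]
    refine sum_mem fun g hg => (supportedSubalgebra H).smul_mem
      (leftReg_mem_supportedSubalgebra (hDH g ?_)) _
    exact Set.mem_iUnion_of_mem n (Set.mem_iUnion_of_mem k hg)
  have h3 : Tendsto (fun k => rhoSum (f n k)) atTop (𝓝 (S n)) := by
    rw [tendsto_iff_dist_tendsto_zero]
    refine squeeze_zero (fun _ => dist_nonneg) (fun k => ?_)
      tendsto_one_div_add_atTop_nhds_zero_nat
    rw [dist_comm]
    exact (hf n k).le
  exact (isClosed_supportedSubalgebra H).mem_of_tendsto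
    ((toOperator.continuous.tendsto _).comp h3) (Eventually.of_forall h2)

theorem inclusionVN_multiplier_toDual (u : FourierAlgebra G) (Q : ReducedCstar G) :
    inclusionVN G (multiplier (toDual u) Q) = arensRight (inclusionVN G Q) u := rfl

/-- Under the assumption of an approximate identity, each element of `C*_ρ(G)` is approximated by
combinations of those `ρ(g)` for which `g` belongs to its support. -/
theorem mem_closure_span_rho {l : Filter (FourierAlgebra G)} {C : ℝ} (hl : l.IsApproximateUnit)
    (hC : ∀ᶠ u in l, ‖ContinuousLinearMap.mul ℂ (FourierAlgebra G) u‖ ≤ C)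
    {D : Set G} {Q : ReducedCstar G} (hQ : ∀ g ∉ D, toDual (pointMass g) Q = 0) :
    Q ∈ (Submodule.span ℂ (rho '' D)).topologicalClosure := by
  have := hl.neBot
  set p := (Submodule.span ℂ (rho '' D)).topologicalClosure with hp
  have hpc : IsClosed (p : Set (ReducedCstar G)) := Submodule.isClosed_topologicalClosure _
  -- `Q` is the limit of `M_u Q`, which is `Q · u` in `VN(G)`. For a point mass in place of `u` this
  -- is a multiple of `ρ(g)`, and it vanishes for `g ∉ D`.
  refine hpc.mem_of_tendsto (tendsto_multiplier hl hC Q) (Eventually.of_forall fun u => ?_)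
  let q : Submodule ℂ (StrongDual ℂ (FourierAlgebra G)) := p.map (inclusionVN G).toLinearMap
  have hq : IsClosed (q : Set (StrongDual ℂ (FourierAlgebra G))) :=
    (AddMonoidHomClass.isometry_of_norm (inclusionVN G)
      norm_inclusionVN).isClosedEmbedding.isClosedMap _ hpc
  have h1 : arensRight (inclusionVN G Q) u ∈ q := by
    refine fourier_mem_of_pointMass (q.comap (arensRight (inclusionVN G Q)).toLinearMap)
      (hq.preimage (arensRight (inclusionVN G Q)).continuous) (fun g => ?_) u
    change arensRight (inclusionVN G Q) (pointMass g) ∈ q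
    rw [arensRight_pointMass]
    by_cases hg : g ∈ D
    · exact q.smul_mem _ ⟨rho g, Submodule.le_topologicalClosure _
        (Submodule.subset_span ⟨g, hg, rfl⟩), rfl⟩
    · rw [inclusionVN_apply, hQ g hg]
      exact (zero_smul ℂ (inclusionVN G (rho g))).symm ▸ q.zero_mem
  obtain ⟨Q', hQ', h2⟩ := h1
  rw [← inclusionVN_multiplier_toDual] at h2
  exact inclusionVN_injective h2 ▸ hQ'

/-- The coefficients of the adjoint are the conjugates of those of `S` at inverse elements. This
traciality allows the passage to real and imaginary parts. -/
theorem norm_star_apply_delta_one (S : ReducedCstar G) :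
    ‖star (toOperator S) (delta 1)‖ = ‖toOperator S (delta 1)‖ := by
  have h1 := ell2_hasSum_sq (star (toOperator S) (delta 1))
  have h2 := (Equiv.inv G).hasSum_iff.mpr (ell2_hasSum_sq (toOperator S (delta 1)))
  have h3 : ∀ g, star (toOperator S) (delta 1) g = conj (toOperator S (delta 1) g⁻¹) := by
    intro g
    rw [← inner_delta_left, ContinuousLinearMap.star_eq_adjoint,
      ContinuousLinearMap.adjoint_inner_right, ← inner_conj_symm, inner_delta_left,
      toOperator_delta, one_mul]
  have h4 : (fun g => ‖star (toOperator S) (delta 1) g‖ ^ 2) =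
      (fun g => ‖toOperator S (delta 1) g‖ ^ 2) ∘ Equiv.inv G := by
    funext g
    rw [h3, RCLike.norm_conj]
    rfl
  rw [h4] at h1
  exact (sq_eq_sq₀ (norm_nonneg _) (norm_nonneg _)).mp (h1.unique h2)

end Support

/-! ### Trace-norm smallness of the multiplier and membership in `A(G)` -/

section Compactness
variable {G : Type*} [Group G]

theorem norm_toOperator_delta (S : ReducedCstar G) (a : G) :
    ‖toOperator S (delta a)‖ = ‖toOperator S (delta 1)‖ := by
  have h1 := ell2_hasSum_sq (toOperator S (delta a))
  have h2 := (Equiv.mulRight a⁻¹).hasSum_iff.mpr (ell2_hasSum_sq (toOperator S (delta 1)))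
  simp only [toOperator_delta S a] at h1
  exact (sq_eq_sq₀ (norm_nonneg _) (norm_nonneg _)).mp (h1.unique h2)

/-- On bounded sets, weak* convergence in `VN(G)` reduces to convergence on the point masses. -/
theorem tendsto_inclusionVN {ι : Type*} {l : Filter ι} {S : ι → ReducedCstar G}
    {S₀ : ReducedCstar G} (hS : ∀ i, ‖S i‖ ≤ 1)
    (h : ∀ g, Tendsto (fun i => toOperator (S i) (delta 1) g) l
      (𝓝 (toOperator S₀ (delta 1) g))) :
    Tendsto (fun i => StrongDual.toWeakDual (inclusionVN G (S i))) l
      (𝓝 (StrongDual.toWeakDual (inclusionVN G S₀))) := by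
  refine tendsto_iff_forall_eval_tendsto_topDualPairing.mpr fun u => ?_
  have hcl := isClosed_setOf_tendsto (f := fun i => inclusionVN G (S i)) (f₀ := inclusionVN G S₀)
    (l := l) (C := 1) (Eventually.of_forall fun i => (norm_inclusionVN (S i)).trans_le (hS i))
  let p : Submodule ℂ (FourierAlgebra G) :=
    { carrier := {u | Tendsto (fun i => inclusionVN G (S i) u) l (𝓝 (inclusionVN G S₀ u))}
      zero_mem' := by simp [tendsto_const_nhds]
      add_mem' := fun {u v} hu hv => by simpa using hu.add hv
      smul_mem' := fun c u hu => by simpa using hu.const_mul c }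
  refine fourier_mem_of_pointMass p hcl (fun g => ?_) u
  change Tendsto (fun i => toDual (pointMass g) (S i)) l (𝓝 (toDual (pointMass g) S₀))
  simp only [toDual_pointMass_apply]
  exact h g

/-- If multiplication with `φ` maps `VN(G)` into `C*_ρ(G)`, then it is small on bounded sequences
in `C*_ρ(G)` which tend to zero in the trace norm. -/
theorem exists_norm_multiplier_le {l : Filter (FourierAlgebra G)} {C : ℝ}
    (hl : l.IsApproximateUnit)
    (hC : ∀ᶠ u in l, ‖ContinuousLinearMap.mul ℂ (FourierAlgebra G) u‖ ≤ C)
    {φ : StrongDual ℂ (ReducedCstar G)}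
    (hφ : ∀ T : StrongDual ℂ (FourierAlgebra G), T.comp (mulBy φ) ∈ (inclusionVN G).range)
    {S : ℕ → ReducedCstar G} (hsa : ∀ n, IsSelfAdjoint (toOperator (S n)))
    (hS : ∀ n, ‖S n‖ ≤ 1) (h0 : Tendsto (fun n => ‖toOperator (S n) (delta 1)‖) atTop (𝓝 0))
    {ε : ℝ} (hε : 0 < ε) : ∃ n, ‖multiplier φ (S n)‖ ≤ ε := by
  obtain ⟨H, hH, hSH⟩ := exists_countable_subgroup S
  let J : ReducedCstar G → WeakDual ℂ (FourierAlgebra G) :=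
    fun P => StrongDual.toWeakDual (inclusionVN G P)
  let K : Set (ReducedCstar G) := {P | toOperator P ∈ supportedSubalgebra H ∧ ‖P‖ ≤ 1}
  let X : Set (WeakDual ℂ (FourierAlgebra G)) := closure (J '' K)
  have hXc : IsCompact X := by
    refine (WeakDual.isCompact_closedBall (𝕜 := ℂ) (E := FourierAlgebra G) 0 1).of_isClosed_subset
      isClosed_closure (closure_minimal ?_ (WeakDual.isClosed_closedBall 0 1))
    rintro _ ⟨P, hP, rfl⟩
    exact toWeakDual_mem_closedBall.mpr ((norm_inclusionVN P).trans_le hP.2)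
  have hXs : ∀ T ∈ X, ∀ g ∉ H, T (pointMass g) = 0 := by
    intro T hT g hg
    refine closure_minimal ?_
      (isClosed_eq (WeakDual.eval_continuous (pointMass g)) continuous_const) hT
    rintro _ ⟨P, hP, rfl⟩
    exact (toDual_pointMass_apply g P).trans (apply_delta_one_eq_zero hP.1 hg)
  -- The product of `φ` with `T` is in `C*_ρ(G)` and still vanishes off `H`, so it lies in the
  -- separable closed span of the `ρ(g)`, `g ∈ H`.
  have hXQ : ∀ T ∈ X, ∃ Q ∈ (Submodule.span ℂ (rho '' (H : Set G))).topologicalClosure,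
      (WeakDual.toStrongDual T).comp (mulBy φ) = inclusionVN G Q := by
    intro T hT
    obtain ⟨Q, hQ⟩ := hφ (WeakDual.toStrongDual T)
    refine ⟨Q, mem_closure_span_rho hl hC fun g hg => ?_, hQ.symm⟩
    have h1 := DFunLike.congr_fun hQ (pointMass g)
    have h2 : WeakDual.toStrongDual T (pointMass g) = 0 := hXs T hT g hg
    rw [ContinuousLinearMap.comp_apply, mulBy_pointMass, map_smul, h2, smul_zero] at h1
    exact h1
  have hHc : (H : Set G).Countable := hH
  obtain ⟨c, hc, hcd⟩ : TopologicalSpace.IsSeparable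
      (closure (Submodule.span ℂ (rho '' (H : Set G)) : Set (ReducedCstar G))) :=
    ((hHc.image rho).isSeparable.span).closure
  have : Countable c := hc
  have : CompactSpace X := isCompact_iff_compactSpace.mp hXc
  have hJ0 : J 0 ∈ X := subset_closure ⟨0, ⟨by
    rw [map_zero]; exact zero_mem _, by simp⟩, rfl⟩
  have : Nonempty X := ⟨⟨J 0, hJ0⟩⟩
  have hε4 : 0 < ε / 4 := by positivity
  let F : c → Set X := fun q => {T | ‖(WeakDual.toStrongDual T.1).comp (mulBy φ) -
    inclusionVN G q.1‖ ≤ ε / 4}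
  have hFc : ∀ q, IsClosed (F q) := by
    intro q
    have h1 := (WeakDual.isClosed_closedBall (inclusionVN G q.1) (ε / 4)).preimage
      ((continuous_toWeakDual_comp (mulBy φ)).comp (continuous_subtype_val (p := (· ∈ X))))
    convert! h1 using 1
    ext T
    exact (mem_closedBall_iff_norm (b := (WeakDual.toStrongDual T.1).comp (mulBy φ))).symm
  have hFu : ⋃ q, F q = Set.univ := by
    refine Set.eq_univ_of_forall fun T => Set.mem_iUnion.mpr ?_
    obtain ⟨Q, hQ, hTQ⟩ := hXQ T.1 T.2
    obtain ⟨q, hq, hqd⟩ := Metric.mem_closure_iff.mp (hcd hQ) (ε / 4) hε4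
    refine ⟨⟨q, hq⟩, ?_⟩
    change ‖_ - _‖ ≤ _
    rw [hTQ, ← map_sub, norm_inclusionVN, ← dist_eq_norm]
    exact hqd.le
  -- Baire's theorem in the compact space `X`. The interior point is then replaced by some `P` in
  -- `K`, whose image is weak*-dense in `X`.
  obtain ⟨q, T₀, hT₀⟩ := nonempty_interior_of_iUnion_of_closed hFc hFu
  obtain ⟨U, hU, hUF⟩ := mem_nhds_subtype X T₀ (F q) |>.mp (mem_interior_iff_mem_nhds.mp hT₀)
  obtain ⟨V, hVU, hVo, hTV⟩ := mem_nhds_iff.mp hU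
  obtain ⟨_, hPV, P, hP, rfl⟩ := mem_closure_iff.mp T₀.2 V hVo hTV
  have hVnhds : V ∈ 𝓝 (J P) := hVo.mem_nhds hPV
  have hVF : ∀ P' ∈ K, J P' ∈ V →
      ‖inclusionVN G (multiplier φ P') - inclusionVN G q.1‖ ≤ ε / 4 := by
    intro P' hP' hP'V
    exact hUF (a := ⟨J P', subset_closure ⟨P', hP', rfl⟩⟩) (hVU hP'V)
  -- Chosen so that the cutoff error `η` contributes at most `ε / 2` after applying `multiplier φ`.
  set η := ε / (2 * (‖φ‖ + 1)) with hη
  have hη0 : 0 < η := by positivity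
  choose d hdN hd1 hd2 hd3 using fun n => exists_cutoff (supportedSubalgebra H)
    (isClosed_supportedSubalgebra H) (hsa n) (hSH n) hη0
  have hsand : ∀ n, ∀ Q ∈ K, ∃ P' ∈ K, toOperator P' =
      star (1 - d n) * toOperator P * (1 - d n) + star (d n) * toOperator Q * d n := by
    intro n Q hQ
    have h1 : star (1 - d n) * toOperator P * (1 - d n) + star (d n) * toOperator Q * d n ∈
        supportedSubalgebra H := by
      have hc' : 1 - d n ∈ supportedSubalgebra H := sub_mem (one_mem _) (hdN n)
      exact add_mem (mul_mem (mul_mem (star_mem hc') hP.1) hc')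
        (mul_mem (mul_mem (star_mem (hdN n)) hQ.1) (hdN n))
    exact ⟨⟨_, supportedSubalgebra_le H h1⟩, ⟨h1, norm_sandwich_le (hd1 n) hP.2 hQ.2⟩, rfl⟩
  -- The cutoff is dominated by `‖S n (delta g)‖ / η`, and by right invariance this does not depend
  -- on `g`.
  have hdl : ∀ g : G, Tendsto (fun n => d n (delta g)) atTop (𝓝 0) := by
    intro g
    refine squeeze_zero_norm (fun n => (hd2 n _).trans_eq ?_) (by simpa using h0.div_const η)
    rw [norm_toOperator_delta]
  -- For any choice of `Q n` in the unit ball the sandwiches tend weak* to `P`: the cutoffs tend to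
  -- zero on every unit vector `delta g`, so the `Q n` term disappears.
  have hlim : ∀ Q : ℕ → ReducedCstar G, (∀ n, Q n ∈ K) → ∀ P' : ℕ → ReducedCstar G,
      (∀ n, P' n ∈ K) → (∀ n, toOperator (P' n) =
      star (1 - d n) * toOperator P * (1 - d n) + star (d n) * toOperator (Q n) * d n) →
      ∀ᶠ n in atTop, J (P' n) ∈ V := by
    intro Q hQ P' hP' hPQ
    refine (tendsto_inclusionVN (S₀ := P) (fun n => (hP' n).2) fun g => ?_).eventually hVnhds
    have hcl : ∀ k : G, Tendsto (fun n => (1 - d n) (delta k)) atTop (𝓝 (delta k)) := by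
      intro k
      simpa using tendsto_const_nhds.sub (hdl k)
    have h1 : Tendsto (fun n => ⟪(1 - d n) (delta g), toOperator P ((1 - d n) (delta 1))⟫_ℂ) atTop
        (𝓝 ⟪delta g, toOperator P (delta 1)⟫_ℂ) :=
      (hcl g).inner (((toOperator P).continuous.tendsto _).comp (hcl 1))
    have h2 : Tendsto (fun n => ⟪d n (delta g), toOperator (Q n) (d n (delta 1))⟫_ℂ) atTop
        (𝓝 0) := by
      have h3 := (hdl g).norm.mul (hdl 1).norm
      rw [norm_zero, mul_zero] at h3
      refine squeeze_zero_norm (fun n => (norm_inner_le_norm _ _).trans ?_) h3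
      gcongr
      exact ((toOperator (Q n)).le_opNorm _).trans
        (mul_le_of_le_one_left (norm_nonneg _) (hQ n).2)
    have h3 := h1.add h2
    rw [add_zero, inner_delta_left] at h3
    refine h3.congr fun n => ?_
    rw [← inner_delta_left, hPQ, ← ContinuousLinearMap.adjoint_inner_right,
      ← ContinuousLinearMap.adjoint_inner_right, ← inner_add_right]
    rfl
  have hK0 : (0 : ReducedCstar G) ∈ K := ⟨by rw [map_zero]; exact zero_mem _, by simp⟩
  -- The sandwiches with `Q = S n` and with `Q = 0` differ by `d* S d`, which is within `η` of `S
  -- n`. Eventually both lie in `V`, where the multiplier varies by at most `ε / 2`.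
  choose P₁ hP₁K hP₁ using fun n => hsand n (S n) ⟨hSH n, hS n⟩
  choose P₂ hP₂K hP₂ using fun n => hsand n 0 hK0
  obtain ⟨n, hn1, hn2⟩ := ((hlim S (fun n => ⟨hSH n, hS n⟩) P₁ hP₁K hP₁).and
    (hlim (fun _ => 0) (fun _ => hK0) P₂ hP₂K hP₂)).exists
  refine ⟨n, ?_⟩
  have h1 : ‖S n - (P₁ n - P₂ n)‖ ≤ η := by
    rw [← norm_toOperator, map_sub, map_sub, hP₁, hP₂, add_sub_add_left_eq_sub, map_zero]
    simpa using hd3 n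
  have h2 : ‖multiplier φ (P₁ n) - multiplier φ (P₂ n)‖ ≤ ε / 2 := by
    rw [← norm_inclusionVN, map_sub]
    refine (norm_sub_le_norm_sub_add_norm_sub _ (inclusionVN G q.1) _).trans ?_
    rw [norm_sub_rev (inclusionVN G q.1)]
    linarith [hVF _ (hP₁K n) hn1, hVF _ (hP₂K n) hn2]
  have h3 : multiplier φ (S n) = multiplier φ (S n - (P₁ n - P₂ n)) +
      (multiplier φ (P₁ n) - multiplier φ (P₂ n)) := by
    rw [← map_sub, ← map_add, sub_add_cancel]
  have h4 : ‖multiplier φ (S n - (P₁ n - P₂ n))‖ ≤ ε / 2 := by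
    refine ((multiplier φ).le_opNorm _).trans ?_
    calc _ ≤ (‖φ‖ + 1) * η := by
          gcongr
          linarith [norm_multiplier_le φ]
      _ = ε / 2 := by rw [hη]; field_simp
  rw [h3]
  linarith [norm_add_le (multiplier φ (S n - (P₁ n - P₂ n)))
    (multiplier φ (P₁ n) - multiplier φ (P₂ n))]

theorem exists_norm_multiplier_le_of_norm_le {l : Filter (FourierAlgebra G)} {C : ℝ}
    (hl : l.IsApproximateUnit)
    (hC : ∀ᶠ u in l, ‖ContinuousLinearMap.mul ℂ (FourierAlgebra G) u‖ ≤ C)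
    {φ : StrongDual ℂ (ReducedCstar G)}
    (hφ : ∀ T : StrongDual ℂ (FourierAlgebra G), T.comp (mulBy φ) ∈ (inclusionVN G).range)
    {ε : ℝ} (hε : 0 < ε) : ∃ δ > 0, ∀ S : ReducedCstar G, ‖S‖ ≤ 1 →
      ‖toOperator S (delta 1)‖ ≤ δ → ‖multiplier φ S‖ ≤ ε := by
  obtain ⟨δ, hδ, h⟩ : ∃ δ > 0, ∀ S : ReducedCstar G, IsSelfAdjoint (toOperator S) → ‖S‖ ≤ 1 →
      ‖toOperator S (delta 1)‖ ≤ δ → ‖multiplier φ S‖ ≤ ε / 2 := by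
    by_contra! hcon
    choose S hsa hS hSd hSε using fun n : ℕ => hcon (1 / ((n : ℝ) + 1)) (by positivity)
    obtain ⟨n, hn⟩ := exists_norm_multiplier_le hl hC hφ hsa hS
      (squeeze_zero (fun _ => norm_nonneg _) hSd tendsto_one_div_add_atTop_nhds_zero_nat)
      (half_pos hε)
    exact absurd hn (not_le.mpr (hSε n))
  refine ⟨δ, hδ, fun S hS hSd => ?_⟩
  have hmem := S.2
  have hstar : star (toOperator S) ∈ reducedCstarSubalgebra G := star_mem hmem
  have hre : (realPart (toOperator S) : ell2 G →L[ℂ] ell2 G) ∈ reducedCstarSubalgebra G := by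
    rw [realPart_apply_coe, ← Complex.coe_smul]
    exact (reducedCstarSubalgebra G).smul_mem (add_mem hmem hstar) _
  have him : (imaginaryPart (toOperator S) : ell2 G →L[ℂ] ell2 G) ∈ reducedCstarSubalgebra G := by
    rw [imaginaryPart_apply_coe, ← Complex.coe_smul]
    exact (reducedCstarSubalgebra G).smul_mem
      ((reducedCstarSubalgebra G).smul_mem (sub_mem hmem hstar) _) _
  have hstarn : ‖star (toOperator S) (delta 1)‖ ≤ δ :=
    (norm_star_apply_delta_one S).trans_le hSd
  let A : ReducedCstar G := ⟨_, hre⟩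
  let B : ReducedCstar G := ⟨_, him⟩
  have hSAB : S = A + Complex.I • B :=
    Subtype.ext (realPart_add_I_smul_imaginaryPart (toOperator S)).symm
  have hA : ‖multiplier φ A‖ ≤ ε / 2 := by
    refine h A (realPart (toOperator S)).2 ((realPart.norm_le (toOperator S)).trans hS) ?_
    change ‖(realPart (toOperator S) : ell2 G →L[ℂ] ell2 G) (delta 1)‖ ≤ δ
    rw [realPart_apply_coe, ← Complex.coe_smul]
    change ‖((2⁻¹ : ℝ) : ℂ) • (toOperator S (delta 1) + star (toOperator S) (delta 1))‖ ≤ δ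
    have := norm_add_le (toOperator S (delta 1)) (star (toOperator S) (delta 1))
    rw [norm_smul, Complex.norm_real, Real.norm_of_nonneg (by norm_num)]
    linarith
  have hB : ‖multiplier φ B‖ ≤ ε / 2 := by
    refine h B (imaginaryPart (toOperator S)).2 ((imaginaryPart.norm_le (toOperator S)).trans hS) ?_
    change ‖(imaginaryPart (toOperator S) : ell2 G →L[ℂ] ell2 G) (delta 1)‖ ≤ δ
    rw [imaginaryPart_apply_coe, ← Complex.coe_smul]
    change ‖(-Complex.I) • ((2⁻¹ : ℝ) : ℂ) •
      (toOperator S (delta 1) - star (toOperator S) (delta 1))‖ ≤ δ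
    have := norm_sub_le (toOperator S (delta 1)) (star (toOperator S) (delta 1))
    rw [norm_smul, norm_smul, norm_neg, Complex.norm_I, Complex.norm_real,
      Real.norm_of_nonneg (by norm_num)]
    linarith
  rw [hSAB, map_add, map_smul]
  refine (norm_add_le _ _).trans ?_
  rw [norm_smul, Complex.norm_I, one_mul]
  linarith

/-- `φψ = ψ ∘ M_φ` is continuous on the unit ball for the trace norm `‖S δ_1‖`. Hence it is a norm
limit of functionals `S ↦ y (S δ_1)`, which are coefficient functionals by Riesz. -/
theorem mulDual_mem_fourierSubmodule {l : Filter (FourierAlgebra G)} {C : ℝ}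
    (hl : l.IsApproximateUnit)
    (hC : ∀ᶠ u in l, ‖ContinuousLinearMap.mul ℂ (FourierAlgebra G) u‖ ≤ C)
    {φ : StrongDual ℂ (ReducedCstar G)}
    (hφ : ∀ T : StrongDual ℂ (FourierAlgebra G), T.comp (mulBy φ) ∈ (inclusionVN G).range)
    (ψ : StrongDual ℂ (ReducedCstar G)) : mulDual φ ψ ∈ fourierSubmodule G := by
  have hcl : IsClosed (fourierSubmodule G : Set (StrongDual ℂ (ReducedCstar G))) :=
    Submodule.isClosed_topologicalClosure _
  let D : ReducedCstar G →L[ℂ] ell2 G :=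
    (ContinuousLinearMap.apply ℂ (ell2 G) (delta (1 : G))).comp toOperator
  refine hcl.closure_subset (Metric.mem_closure_iff.mpr fun ε hε => ?_)
  obtain ⟨y, hy⟩ := exists_norm_sub_comp_le D (mulDual φ ψ) (fun ε hε => by
    obtain ⟨δ, hδ, h⟩ := exists_norm_multiplier_le_of_norm_le hl hC hφ
      (ε := ε / (‖ψ‖ + 1)) (by positivity)
    refine ⟨δ, hδ, fun S hS hSd => (ψ.le_opNorm _).trans ?_⟩
    calc _ ≤ (‖ψ‖ + 1) * (ε / (‖ψ‖ + 1)) := by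
          gcongr
          · linarith
          · exact h S hS hSd
      _ = ε := by field_simp) (half_pos hε)
  refine ⟨y.comp D, ?_, ?_⟩
  · have h1 : y.comp D = coeffFunctional (delta 1) ((InnerProductSpace.toDual ℂ (ell2 G)).symm y) :=
      ContinuousLinearMap.ext fun S => InnerProductSpace.toDual_symm_apply.symm
    rw [h1]
    exact coeffFunctional_mem _ _
  · rw [dist_eq_norm]
    linarith

end Compactness

/-! ### The topological centre and weak compactness -/

section Centre
variable {G : Type*} [Group G]

theorem toFunction_comp_inclusionVN (Φ : StrongDual ℂ (StrongDual ℂ (FourierAlgebra G))) :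
    toFunction (Φ.comp (inclusionVN G)) = restrictionMap Φ := rfl

theorem arensProduct_apply (Φ Ψ : StrongDual ℂ (StrongDual ℂ (FourierAlgebra G)))
    (T : StrongDual ℂ (FourierAlgebra G)) :
    arensProduct Φ Ψ T = Φ (T.comp (mulBy (Ψ.comp (inclusionVN G)))) := by
  rw [← arensLeft_eq]; rfl

theorem arensLeft_inclusion (T : StrongDual ℂ (FourierAlgebra G)) (u : FourierAlgebra G) :
    arensLeft (NormedSpace.inclusionInDoubleDual ℂ _ u) T = arensRight T u := by
  refine ContinuousLinearMap.ext fun b => ?_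
  change T (b * u) = T (u * b)
  rw [mul_comm]

theorem apply_arensRight (Φ : StrongDual ℂ (StrongDual ℂ (FourierAlgebra G)))
    (T : StrongDual ℂ (FourierAlgebra G)) (u : FourierAlgebra G) :
    Φ (arensRight T u) = T (mulBy (Φ.comp (inclusionVN G)) u) := by
  have h : Φ.comp (arensRight T) = T.comp (mulBy (Φ.comp (inclusionVN G))) := by
    refine fourier_hom_ext fun g => ?_
    rw [ContinuousLinearMap.comp_apply, ContinuousLinearMap.comp_apply, arensRight_pointMass,
      mulBy_pointMass, map_smul, map_smul]
    exact mul_comm _ _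
  exact DFunLike.congr_fun h u

/-- A weak*-continuous functional of `Ψ` is evaluation at some `T'` in `VN(G)`; taking `Ψ` in `A(G)`
identifies `T'`. In effect `Φ □ Ψ = Ψ □ Φ`. -/
theorem arensProduct_of_mem_topologicalCentre
    {Φ : StrongDual ℂ (StrongDual ℂ (FourierAlgebra G))}
    (hΦ : Φ ∈ topologicalCentre (FourierAlgebra G))
    (Ψ : StrongDual ℂ (StrongDual ℂ (FourierAlgebra G))) (T : StrongDual ℂ (FourierAlgebra G)) :
    arensProduct Φ Ψ T = Ψ (T.comp (mulBy (Φ.comp (inclusionVN G)))) := by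
  have hc : Continuous fun Ψ : WeakDual ℂ (StrongDual ℂ (FourierAlgebra G)) =>
      arensProduct Φ (WeakDual.toStrongDual Ψ) T := (WeakDual.eval_continuous T).comp hΦ
  let f : WeakDual ℂ (StrongDual ℂ (FourierAlgebra G)) →L[ℂ] ℂ :=
    { toFun := fun Ψ => arensProduct Φ (WeakDual.toStrongDual Ψ) T
      map_add' := fun Ψ Ψ' => by
        have h : arensLeft (WeakDual.toStrongDual (Ψ + Ψ')) T =
            arensLeft (WeakDual.toStrongDual Ψ) T + arensLeft (WeakDual.toStrongDual Ψ') T := rfl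
        exact (congrArg Φ h).trans (map_add _ _ _)
      map_smul' := fun c Ψ => by
        have h : arensLeft (WeakDual.toStrongDual (c • Ψ)) T =
            c • arensLeft (WeakDual.toStrongDual Ψ) T := rfl
        exact (congrArg Φ h).trans (map_smul _ _ _)
      cont := hc }
  obtain ⟨T', hT'⟩ := exists_eval_of_continuous f
  have h1 : T' = T.comp (mulBy (Φ.comp (inclusionVN G))) := by
    refine ContinuousLinearMap.ext fun u => ?_
    have h2 := hT' (NormedSpace.inclusionInDoubleDual ℂ _ u)
    rw [ContinuousLinearMap.comp_apply, ← apply_arensRight, ← arensLeft_inclusion]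
    exact h2.symm
  rw [← h1]
  exact hT' Ψ

/-- If `Ψ` annihilates `C*_ρ(G)`, then `Ψ · T = 0`, because `A' · A` lies in `C*_ρ(G)`. Hahn–Banach
turns this into membership. -/
theorem comp_mulBy_mem_range {Φ : StrongDual ℂ (StrongDual ℂ (FourierAlgebra G))}
    (hΦ : Φ ∈ topologicalCentre (FourierAlgebra G)) (T : StrongDual ℂ (FourierAlgebra G)) :
    T.comp (mulBy (Φ.comp (inclusionVN G))) ∈ (inclusionVN G).range := by
  refine mem_of_forall_dual_eq_zero _ isClosed_range_inclusionVN fun Ψ hΨ => ?_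
  rw [← arensProduct_of_mem_topologicalCentre hΦ]
  have h : arensLeft Ψ T = 0 := ContinuousLinearMap.ext fun a => hΨ _ (arensRight_mem_range T a)
  exact (congrArg Φ h).trans (map_zero _)

theorem isWeaklyCompactOperator_mulBy {l : Filter (FourierAlgebra G)} {C : ℝ}
    (hl : l.IsApproximateUnit)
    (hC : ∀ᶠ u in l, ‖ContinuousLinearMap.mul ℂ (FourierAlgebra G) u‖ ≤ C)
    {φ : StrongDual ℂ (ReducedCstar G)}
    (hφ : ∀ T : StrongDual ℂ (FourierAlgebra G), T.comp (mulBy φ) ∈ (inclusionVN G).range) :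
    IsWeaklyCompactOperator (mulBy φ) := by
  have := hl.neBot
  refine isWeaklyCompactOperator_of_forall _ fun Ψ => ?_
  set ψ := Ψ.comp (inclusionVN G) with hψ
  -- `w = φψ` represents the second adjoint of `L_φ` at `Ψ`. The approximate identity yields `T(u w)
  -- → T(w)` and `ψ(M_u S) → ψ(S) = Ψ(T ∘ L_φ)`, and the two terms agree for every `u`.
  let w : FourierAlgebra G := ⟨mulDual φ ψ, mulDual_mem_fourierSubmodule hl hC hφ ψ⟩
  refine ⟨w, fun T => ?_⟩
  obtain ⟨S, hS⟩ := hφ T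
  have h1 : Tendsto (fun u => T (u * w)) l (𝓝 (T w)) :=
    (T.continuous.tendsto _).comp (hl.tendsto_mul_right w)
  have h2 : Tendsto (fun u => ψ (multiplier (toDual u) S)) l (𝓝 (ψ S)) :=
    (ψ.continuous.tendsto _).comp (tendsto_multiplier hl hC S)
  have h3 : ∀ u : FourierAlgebra G, T (u * w) = ψ (multiplier (toDual u) S) := by
    intro u
    have h4 : u * w = mulBy φ (mulBy ψ u) := fourier_ext fun g => by
      rw [mul_apply, mulBy_apply, mulBy_apply]
      have : w g = toFunction φ g * toFunction ψ g := toFunction_mulDual φ ψ g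
      rw [this]; ring
    have h5 : T (mulBy φ (mulBy ψ u)) = mulDual ψ (toDual u) S :=
      (DFunLike.congr_fun hS (mulBy ψ u)).symm
    rw [h4, h5, mulDual_comm]
    rfl
  simp only [h3] at h1
  rw [← hS]
  exact tendsto_nhds_unique h2 h1

theorem exists_mem_topologicalCentre {l : Filter (FourierAlgebra G)} {C : ℝ}
    (hl : l.IsApproximateUnit)
    (hC : ∀ᶠ u in l, ‖ContinuousLinearMap.mul ℂ (FourierAlgebra G) u‖ ≤ C)
    {φ : StrongDual ℂ (ReducedCstar G)} (hφ : IsWeaklyCompactOperator (mulBy φ)) :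
    ∃ Φ ∈ topologicalCentre (FourierAlgebra G), Φ.comp (inclusionVN G) = φ := by
  have := hl.neBot
  let 𝒰 : Ultrafilter (FourierAlgebra G) := Ultrafilter.of l
  have h𝒰 : (𝒰 : Filter (FourierAlgebra G)) ≤ l := Ultrafilter.of_le l
  have hl' : (𝒰 : Filter (FourierAlgebra G)).IsApproximateUnit :=
    { tendsto_mul_left := fun m => (hl.tendsto_mul_left m).mono_left h𝒰
      tendsto_mul_right := fun m => (hl.tendsto_mul_right m).mono_left h𝒰 }
  let J : FourierAlgebra G → WeakDual ℂ (StrongDual ℂ (FourierAlgebra G)) := fun u =>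
    StrongDual.toWeakDual (NormedSpace.inclusionInDoubleDual ℂ _ (mulBy φ u))
  have hK := WeakDual.isCompact_closedBall (𝕜 := ℂ)
    (E := StrongDual ℂ (FourierAlgebra G)) 0 (‖φ‖ * C)
  -- `Φ` is the weak* limit of `φ u` along the ultrafilter, which exists since these products are
  -- bounded by `‖φ‖ * C`.
  obtain ⟨Φ, -, hΦ⟩ := hK.ultrafilter_le_nhds (𝒰.map J) (by
    refine le_principal_iff.mpr (h𝒰 ?_)
    filter_upwards [hC] with u hu
    refine toWeakDual_mem_closedBall.mpr ((NormedSpace.double_dual_bound ℂ _ _).trans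
      ((norm_mulBy_apply_le φ u).trans ?_))
    gcongr)
  have hlim : ∀ T : StrongDual ℂ (FourierAlgebra G),
      Tendsto (fun u => T (mulBy φ u)) 𝒰 (𝓝 (WeakDual.toStrongDual Φ T)) := fun T =>
    ((WeakDual.eval_continuous T).tendsto Φ).comp hΦ
  have h1 : (WeakDual.toStrongDual Φ).comp (inclusionVN G) = φ := by
    refine toFunction_injective (funext fun g => ?_)
    refine tendsto_nhds_unique (hlim (inclusionVN G (rho g))) ?_
    have h2 := (tendsto_coe_approximateUnit hl' g).const_mul (toFunction φ g)
    rw [mul_one] at h2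
    exact h2.congr fun u => (mulBy_apply φ u g).symm
  refine ⟨WeakDual.toStrongDual Φ, ?_, h1⟩
  have h2 : ∀ (Ψ : StrongDual ℂ (StrongDual ℂ (FourierAlgebra G)))
      (T : StrongDual ℂ (FourierAlgebra G)),
      arensProduct (WeakDual.toStrongDual Φ) Ψ T = Ψ (T.comp (mulBy φ)) := by
    intro Ψ T
    set ψ := Ψ.comp (inclusionVN G) with hψ
    -- Weak compactness enters here: it gives an element of `A(G)` that must be the function `φψ`.
    -- Then `ψ(φu) = u w → w` in norm, which evaluates `Φ □ Ψ`.
    obtain ⟨w, hw⟩ := hφ.exists_eq Ψ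
    have hwg : ∀ g, w g = toFunction φ g * toFunction ψ g := by
      intro g
      have h3 : (inclusionVN G (rho g)).comp (mulBy φ) = toFunction φ g • inclusionVN G (rho g) := by
        refine ContinuousLinearMap.ext fun u => ?_
        exact mulBy_apply φ u g
      have h4 := hw (inclusionVN G (rho g))
      rw [h3, map_smul] at h4
      exact h4.symm
    rw [arensProduct_apply, ← hψ, hw]
    refine tendsto_nhds_unique (hlim _) ?_
    have h3 : Tendsto (fun u => T (u * w)) 𝒰 (𝓝 (T w)) :=
      (T.continuous.tendsto _).comp (hl'.tendsto_mul_right w)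
    have h4 : ∀ u : FourierAlgebra G, u * w = mulBy ψ (mulBy φ u) := fun u =>
      fourier_ext fun g => by
        rw [mul_apply, hwg, mulBy_apply, mulBy_apply]
        ring
    exact h3.congr fun u => congrArg T (h4 u)
  refine WeakDual.continuous_of_continuous_eval fun T => ?_
  exact (WeakDual.eval_continuous (T.comp (mulBy φ))).congr fun Ψ =>
    (h2 (WeakDual.toStrongDual Ψ) T).symm

end Centre

end FourierBidual

end

theorem proposition3 {G : Type*} [Group G]
    (h : FourierBidual.HasMultiplierBoundedApproximateIdentity (FourierBidual.FourierAlgebra G)) :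
    FourierBidual.restrictionMap ''
        FourierBidual.topologicalCentre (FourierBidual.FourierAlgebra G) =
      {v : G → ℂ | ∃ hv : v ∈ FourierBidual.reducedFourierStieltjes G,
        FourierBidual.IsWeaklyCompactOperator (FourierBidual.mulOperator ⟨v, hv⟩)} := by
  obtain ⟨l, C, hl, hC⟩ := h
  ext v
  constructor
  · rintro ⟨Φ, hΦ, rfl⟩
    refine ⟨FourierBidual.toFunction_mem_reducedFourierStieltjes hl hC _, ?_⟩
    rw [FourierBidual.mulOperator_eq_mulBy _ (FourierBidual.toFunction_comp_inclusionVN Φ)]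
    exact FourierBidual.isWeaklyCompactOperator_mulBy hl hC
      (FourierBidual.comp_mulBy_mem_range hΦ)
  · rintro ⟨hv, hw⟩
    obtain ⟨φ, hφ⟩ := FourierBidual.exists_dual_of_mem hv
    rw [FourierBidual.mulOperator_eq_mulBy ⟨v, hv⟩ hφ] at hw
    obtain ⟨Φ, hΦ, hΦφ⟩ := FourierBidual.exists_mem_topologicalCentre hl hC hw
    refine ⟨Φ, hΦ, ?_⟩
    rw [← FourierBidual.toFunction_comp_inclusionVN, hΦφ, hφ]
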